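/- **Definitions.** A *Hilbert space with a one-dimensional coordinate system* is a pair $(\mathcal H,E)$ of a complex Hilbert space $\mathcal H$ and a spectral measure $E$ on $\mathbb R$, that is, a countably additive map from the Borel subsets of $\mathbb R$ to the orthogonal projections of $\mathcal H$ with $E(\mathbb R)=1$. Put $v_E(k)=\int_{\mathbb R}e^{ikx}\,dE(x)$ for $k\in\mathbb R$. Let $(\mathcal H_1,E_1)$, $(\mathcal H_2,E_2)$ be two such pairs. A bounded operator $W\colon\mathcal H_1\to\mathcal H_2$ * has *finite propagation* if there is a constant $R$ with $E_2(A_2)WE_1(A_1)=0$ for all Borel sets $A_1,A_2\subset\mathbb R$ with $\mathrm{dist}(A_1,A_2)>R$; * is *smooth* (resp. *uniform*) if the map $k\mapsto v_{E_2}(k)\,W\,v_{E_1}(-k)$ from $\mathbb R$ to the bounded operators with the operator norm is $C^\infty$ (resp. continuous). A *one-dimensional quantum walk* is a triple $(\mathcal H,(U^t)_{t\in\mathbb Z},E)$ with $(\mathcal H,E)$ as above and $U$ a unitary operator on $\mathcal H$. An *intertwiner* from $(\mathcal H_1,(U_1^t),E_1)$ to $(\mathcal H_2,(U_2^t),E_2)$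 is a bounded operator $T\colon\mathcal H_1\to\mathcal H_2$ with $TU_1=U_2T$. Two walks are *similar* if there is a smooth invertible intertwiner between them. Let $\mathbb T=\{z\in\mathbb C:|z|=1\}$, let $\lambda\colon\mathbb R\to\mathbb T$ be analytic and let $p>0$ be a period of $\lambda$. The *model quantum walk* $\widehat U_{\lambda,p}$ is $\bigl(L^2(\mathbb R/p\mathbb Z),(M[\lambda]^t)_{t\in\mathbb Z},\tfrac1i\tfrac{d}{dk}\bigr)$, where $L^2$ is taken with respect to the normalized Haar measure, $M[\lambda]$ is multiplication by $\lambda$, and $\tfrac1i\tfrac{d}{dk}$ stands for its spectral measure: a Borel set $A$ is sent to the orthogonal projection onto the closed span of the functions $k\mapsto e^{ixk}$ with $x\in\tfrac{2\pi}{p}\mathbb Z\cap A$. **Theorem.** Let $\lambda_1,\lambda_2\colon\mathbb R\to\mathbb T$ be non-constant periodic analytic functions with minimal (positive) periods $p(1)$, $p(2)$. The following conditions are equivalent: 1. there is a real number $l$ such that $\lambda_2(k)=\lambda_1(k-l)$ for every $k\in\mathbb R$; 2. there is a unitary intertwiner with finite propagation from $\widehat U_{\lambda_1,p(1)}$ to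 $\widehat U_{\lambda_2,p(2)}$; 3. the walks $\widehat U_{\lambda_1,p(1)}$ and $\widehat U_{\lambda_2,p(2)}$ are similar; 4. there is a non-zero uniform intertwiner from $\widehat U_{\lambda_1,p(1)}$ to $\widehat U_{\lambda_2,p(2)}$. -/

import Mathlib

open MeasureTheory Set
open scoped ENNReal NNReal ContDiff InnerProductSpace

namespace QW

/-! ### Hilbert spaces with a one-dimensional coordinate system -/

/-- A spectral measure on `ℝ` with values in the orthogonal projections of `H`: it is countably
additive (in the strong operator topology) and normalized. Such an `E` makes `H` a Hilbert space
with a one-dimensional coordinate system. -/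
structure SpectralMeasure (H : Type*) [NormedAddCommGroup H] [InnerProductSpace ℂ H]
    [CompleteSpace H] where
  /-- the projection attached to a set (only its values on Borel sets matter) -/
  proj : Set ℝ → H →L[ℂ] H
  isStarProjection_proj : ∀ A, MeasurableSet A → IsStarProjection (proj A)
  hasSum_proj_iUnion : ∀ A : ℕ → Set ℝ, (∀ n, MeasurableSet (A n)) →
    Pairwise (fun m n => Disjoint (A m) (A n)) →
    ∀ ξ : H, HasSum (fun n => proj (A n) ξ) (proj (⋃ n, A n) ξ)
  proj_univ : proj univ = 1

namespace SpectralMeasure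

variable {H : Type*} [NormedAddCommGroup H] [InnerProductSpace ℂ H] [CompleteSpace H]

theorem inner_proj (E : SpectralMeasure H) {A : Set ℝ} (hA : MeasurableSet A) (ξ : H) :
    ⟪ξ, E.proj A ξ⟫_ℂ = ((‖E.proj A ξ‖ ^ 2 : ℝ) : ℂ) := by
  have h := E.isStarProjection_proj A hA
  have h1 : E.proj A (E.proj A ξ) = E.proj A ξ := by
    have := congrArg (fun T : H →L[ℂ] H => T ξ) h.isIdempotentElem.eq
    simpa using this
  have h2 : ContinuousLinearMap.adjoint (E.proj A) = E.proj A := h.isSelfAdjoint.star_eq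
  rw [← h1, ← ContinuousLinearMap.adjoint_inner_left, h2, h1, inner_self_eq_norm_sq_to_K]
  simp

theorem proj_empty (E : SpectralMeasure H) : E.proj ∅ = 0 := by
  ext ξ
  have h := E.hasSum_proj_iUnion (fun _ => ∅) (fun _ => MeasurableSet.empty)
    (fun _ _ _ => by simp) ξ
  have := h.summable.tendsto_atTop_zero
  simpa using tendsto_nhds_unique tendsto_const_nhds this

/-- The measure `μ_ξ(A) = ⟨E(A) ξ, ξ⟩` on `ℝ`. -/
noncomputable def vecMeasure (E : SpectralMeasure H) (ξ : H) : Measure ℝ :=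
  Measure.ofMeasurable (fun A _ => ENNReal.ofReal (⟪ξ, E.proj A ξ⟫_ℂ).re)
    (by simp [E.proj_empty])
    (by
      intro A hA hd
      have h := E.hasSum_proj_iUnion A hA hd ξ
      have h2 : HasSum (fun n => (⟪ξ, E.proj (A n) ξ⟫_ℂ).re) (⟪ξ, E.proj (⋃ n, A n) ξ⟫_ℂ).re :=
        Complex.reCLM.hasSum ((innerSL ℂ ξ).hasSum h)
      rw [← h2.tsum_eq, ENNReal.ofReal_tsum_of_nonneg _ h2.summable]
      intro n
      rw [E.inner_proj (hA n), Complex.ofReal_re]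
      positivity)

theorem vecMeasure_apply (E : SpectralMeasure H) (ξ : H) {A : Set ℝ} (hA : MeasurableSet A) :
    E.vecMeasure ξ A = ENNReal.ofReal (⟪ξ, E.proj A ξ⟫_ℂ).re :=
  Measure.ofMeasurable_apply A hA

instance (E : SpectralMeasure H) (ξ : H) : IsFiniteMeasure (E.vecMeasure ξ) :=
  ⟨by rw [E.vecMeasure_apply ξ MeasurableSet.univ]; exact ENNReal.ofReal_lt_top⟩

theorem vecMeasure_real (E : SpectralMeasure H) (ξ : H) {A : Set ℝ} (hA : MeasurableSet A) :
    (((E.vecMeasure ξ).real A : ℝ) : ℂ) = ⟪ξ, E.proj A ξ⟫_ℂ := by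
  rw [Measure.real, E.vecMeasure_apply ξ hA, E.inner_proj hA, Complex.ofReal_re,
    ENNReal.toReal_ofReal (by positivity)]

theorem vecMeasure_real_univ (E : SpectralMeasure H) (ξ : H) :
    (E.vecMeasure ξ).real univ = ‖ξ‖ ^ 2 := by
  have h := E.vecMeasure_real ξ MeasurableSet.univ
  rw [E.inner_proj MeasurableSet.univ, E.proj_univ] at h
  exact_mod_cast h

theorem norm_le_of_quadratic (T : H →L[ℂ] H) {c : ℝ} (hc : 0 ≤ c)
    (h : ∀ ξ : H, ‖⟪ξ, T ξ⟫_ℂ‖ ≤ c * ‖ξ‖ ^ 2) : ‖T‖ ≤ 2 * c := by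
  have key : ∀ x y : H, ‖⟪T y, x⟫_ℂ‖ ≤ c * (‖x‖ ^ 2 + ‖y‖ ^ 2) := by
    intro x y
    have h' : ∀ ξ : H, ‖⟪T ξ, ξ⟫_ℂ‖ ≤ c * ‖ξ‖ ^ 2 := fun ξ => by
      rw [norm_inner_symm]; exact h ξ
    have hp := inner_map_polarization (T : H →ₗ[ℂ] H) x y
    simp only [ContinuousLinearMap.coe_coe] at hp
    have p1 := parallelogram_law_with_norm ℂ x y
    have p2 := parallelogram_law_with_norm ℂ x (Complex.I • y)
    have hI : ‖Complex.I • y‖ = ‖y‖ := by simp [norm_smul]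
    rw [hI] at p2
    have e1 := h' (x + y)
    have e2 := h' (x - y)
    have e3 := h' (x + Complex.I • y)
    have e4 := h' (x - Complex.I • y)
    rw [hp, norm_div]
    have n1 : ∀ a b d e : ℂ, ‖a - b + Complex.I * d - Complex.I * e‖
        ≤ ‖a‖ + ‖b‖ + ‖d‖ + ‖e‖ := by
      intro a b d e
      have t1 := norm_sub_le (a - b + Complex.I * d) (Complex.I * e)
      have t2 := norm_add_le (a - b) (Complex.I * d)
      have t3 := norm_sub_le a b
      simp only [norm_mul, Complex.norm_I, one_mul] at t1 t2
      linarith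
    have n2 := n1 ⟪T (x + y), x + y⟫_ℂ ⟪T (x - y), x - y⟫_ℂ
      ⟪T (x + Complex.I • y), x + Complex.I • y⟫_ℂ ⟪T (x - Complex.I • y), x - Complex.I • y⟫_ℂ
    have h4 : ‖(4 : ℂ)‖ = 4 := by simp
    rw [h4, div_le_iff₀ (by norm_num)]
    refine n2.trans ?_
    nlinarith
  refine T.opNorm_le_bound (by positivity) fun ξ => ?_
  by_cases hz : T ξ = 0
  · rw [hz, norm_zero]; positivity
  have hz' : 0 < ‖T ξ‖ := norm_pos_iff.mpr hz
  have hx : ξ ≠ 0 := fun h0 => hz (by simp [h0])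
  have hx' : 0 < ‖ξ‖ := norm_pos_iff.mpr hx
  have hk := key (((‖ξ‖ / ‖T ξ‖ : ℝ) : ℂ) • T ξ) ξ
  rw [inner_smul_right, inner_self_eq_norm_sq_to_K, norm_smul, norm_mul, Complex.norm_real,
    Real.norm_of_nonneg (by positivity), norm_pow] at hk
  have hn : ‖((‖T ξ‖ : ℝ) : ℂ)‖ = ‖T ξ‖ := by simp
  have ha : ‖ξ‖ / ‖T ξ‖ * ‖T ξ‖ = ‖ξ‖ := by field_simp
  have hb : ‖ξ‖ / ‖T ξ‖ * ‖T ξ‖ ^ 2 = ‖ξ‖ * ‖T ξ‖ := by field_simp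
  erw [hn] at hk
  rw [ha, hb] at hk
  nlinarith

/-- The operator `∫ s dE` for a simple function `s`. -/
noncomputable def simpleIntegral (E : SpectralMeasure H) (s : SimpleFunc ℝ ℂ) : H →L[ℂ] H :=
  ∑ c ∈ s.range, c • E.proj (s ⁻¹' {c})

theorem inner_simpleIntegral (E : SpectralMeasure H) (s : SimpleFunc ℝ ℂ) (ξ : H) :
    ⟪ξ, E.simpleIntegral s ξ⟫_ℂ = ∫ x, s x ∂(E.vecMeasure ξ) := by
  have hi : Integrable s (E.vecMeasure ξ) := SimpleFunc.integrable_of_isFiniteMeasure s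
  have h1 := SimpleFunc.integral_eq_integral s hi
  rw [← h1, SimpleFunc.integral_eq, simpleIntegral, _root_.sum_apply, inner_sum]
  refine Finset.sum_congr rfl fun c _ => ?_
  rw [_root_.smul_apply, inner_smul_right,
    ← E.vecMeasure_real ξ (s.measurableSet_fiber c), Complex.real_smul, mul_comm]

/-- A bounded measurable function has an integral against a spectral measure. -/
theorem exists_integral (E : SpectralMeasure H) (f : ℝ → ℂ) (hf : Measurable f)
    (hb : ∀ x, ‖f x‖ ≤ 1) :
    ∃ T : H →L[ℂ] H, ∀ ξ : H, ⟪ξ, T ξ⟫_ℂ = ∫ x, f x ∂(E.vecMeasure ξ) := by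
  have happ : ∀ n : ℕ, ∃ s : SimpleFunc ℝ ℂ, ∀ x, ‖s x - f x‖ ≤ 1 / ((n : ℝ) + 1) := by
    intro n
    have hpos : (0 : ℝ) < 1 / ((n : ℝ) + 1) := by positivity
    let e := TopologicalSpace.denseSeq ℂ
    obtain ⟨t, ht⟩ := (isCompact_closedBall (0 : ℂ) 1).elim_finite_subcover
      (fun i : ℕ => Metric.ball (e i) (1 / ((n : ℝ) + 1))) (fun _ => Metric.isOpen_ball) (by
        intro z _
        obtain ⟨i, hi⟩ := (TopologicalSpace.denseRange_denseSeq ℂ).exists_dist_lt z hpos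
        exact mem_iUnion.mpr ⟨i, by simpa [Metric.mem_ball] using hi⟩)
    let N := t.sup id
    let g : SimpleFunc ℂ ℂ := (SimpleFunc.nearestPt e N)
    refine ⟨g.comp f hf, fun x => ?_⟩
    have hx : f x ∈ Metric.closedBall (0 : ℂ) 1 := by simpa using hb x
    obtain ⟨i, hi, hxi⟩ := mem_iUnion₂.mp (ht hx)
    have h1 : edist (g (f x)) (f x) ≤ edist (e i) (f x) :=
      SimpleFunc.edist_nearestPt_le e (f x) (Finset.le_sup (f := id) hi)
    rw [edist_dist, edist_dist, ENNReal.ofReal_le_ofReal_iff dist_nonneg] at h1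
    rw [SimpleFunc.coe_comp, Function.comp_apply, ← dist_eq_norm]
    exact h1.trans (by rw [dist_comm]; exact (Metric.mem_ball.mp hxi).le)
  choose s hs using happ
  have hint : ∀ n ξ, Integrable (s n) (E.vecMeasure ξ) := fun n ξ =>
    SimpleFunc.integrable_of_isFiniteMeasure _
  have hfi : ∀ ξ, Integrable f (E.vecMeasure ξ) := fun ξ =>
    Integrable.of_bound hf.aestronglyMeasurable 1 (Filter.Eventually.of_forall hb)
  have hdiff : ∀ m n, ‖E.simpleIntegral (s m) - E.simpleIntegral (s n)‖
      ≤ 2 * (1 / ((m : ℝ) + 1) + 1 / ((n : ℝ) + 1)) := by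
    intro m n
    refine norm_le_of_quadratic _ (by positivity) fun ξ => ?_
    rw [_root_.sub_apply, inner_sub_right, E.inner_simpleIntegral,
      E.inner_simpleIntegral, ← integral_sub (hint m ξ) (hint n ξ), ← E.vecMeasure_real_univ ξ]
    refine norm_integral_le_of_norm_le_const (Filter.Eventually.of_forall fun x => ?_)
    have h1 := hs m x
    have h2 := hs n x
    have h3 : s m x - s n x = (s m x - f x) - (s n x - f x) := by ring
    rw [h3]
    exact (norm_sub_le _ _).trans (add_le_add h1 h2)
  have hlim : Filter.Tendsto (fun n : ℕ => 1 / ((n : ℝ) + 1)) Filter.atTop (nhds 0) :=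
    tendsto_one_div_add_atTop_nhds_zero_nat
  have hcau : CauchySeq fun n => E.simpleIntegral (s n) := by
    refine cauchySeq_of_le_tendsto_0 (fun N : ℕ => 4 * (1 / ((N : ℝ) + 1))) ?_
      (by simpa using hlim.const_mul 4)
    intro m n N hm hn
    rw [dist_eq_norm]
    have a1 := Nat.one_div_le_one_div (α := ℝ) hm
    have a2 := Nat.one_div_le_one_div (α := ℝ) hn
    have := hdiff m n
    linarith
  obtain ⟨T, hT⟩ := cauchySeq_tendsto_of_complete hcau
  refine ⟨T, fun ξ => ?_⟩
  have t1 : Filter.Tendsto (fun n => ⟪ξ, E.simpleIntegral (s n) ξ⟫_ℂ) Filter.atTop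
      (nhds ⟪ξ, T ξ⟫_ℂ) := by
    have c1 : Continuous fun S : H →L[ℂ] H => ⟪ξ, S ξ⟫_ℂ := by fun_prop
    exact (c1.tendsto T).comp hT
  have t2 : Filter.Tendsto (fun n => ⟪ξ, E.simpleIntegral (s n) ξ⟫_ℂ) Filter.atTop
      (nhds (∫ x, f x ∂(E.vecMeasure ξ))) := by
    rw [tendsto_iff_norm_sub_tendsto_zero]
    refine squeeze_zero (fun _ => norm_nonneg _) (fun n => ?_)
      (by simpa using hlim.mul_const ((E.vecMeasure ξ).real univ))
    rw [E.inner_simpleIntegral, ← integral_sub (hint n ξ) (hfi ξ)]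
    exact norm_integral_le_of_norm_le_const
      (Filter.Eventually.of_forall fun x => by simpa using hs n x)
  exact tendsto_nhds_unique t1 t2

theorem exists_waveRep (E : SpectralMeasure H) (k : ℝ) : ∃ T : H →L[ℂ] H, ∀ ξ : H,
    ⟪ξ, T ξ⟫_ℂ = ∫ x : ℝ, Complex.exp (Complex.I * x * k) ∂(E.vecMeasure ξ) := by
  refine E.exists_integral _ (by fun_prop) fun x => ?_
  have : Complex.I * x * k = ((x * k : ℝ) : ℂ) * Complex.I := by push_cast; ring
  rw [this, Complex.norm_exp_ofReal_mul_I]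

/-- The operator `v_E(k) = ∫ exp(i x k) dE(x)`, that is, the bounded operator with
`⟨ξ, v_E(k) ξ⟩ = ∫ exp(i x k) dμ_ξ(x)` for all `ξ` (see `inner_waveRep` and
`eq_waveRep`). -/
noncomputable def waveRep (E : SpectralMeasure H) (k : ℝ) : H →L[ℂ] H :=
  (E.exists_waveRep k).choose

theorem inner_waveRep (E : SpectralMeasure H) (k : ℝ) (ξ : H) :
    ⟪ξ, E.waveRep k ξ⟫_ℂ = ∫ x : ℝ, Complex.exp (Complex.I * x * k) ∂(E.vecMeasure ξ) :=
  (E.exists_waveRep k).choose_spec ξ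

theorem eq_waveRep (E : SpectralMeasure H) (k : ℝ) (T : H →L[ℂ] H)
    (hT : ∀ ξ : H, ⟪ξ, T ξ⟫_ℂ = ∫ x : ℝ, Complex.exp (Complex.I * x * k) ∂(E.vecMeasure ξ)) :
    T = E.waveRep k := by
  have h : ‖T - E.waveRep k‖ ≤ 2 * 0 := norm_le_of_quadratic _ le_rfl fun ξ => by
    simp [hT ξ, E.inner_waveRep k ξ]
  exact sub_eq_zero.mp (norm_le_zero_iff.mp (by simpa using h))

end SpectralMeasure

/-! ### Regularity of morphisms -/

section Regularity

variable {H₁ H₂ : Type*} [NormedAddCommGroup H₁] [InnerProductSpace ℂ H₁] [CompleteSpace H₁]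
  [NormedAddCommGroup H₂] [InnerProductSpace ℂ H₂] [CompleteSpace H₂]

/-- The distance `dist(A, B) = inf {|a - b| : a ∈ A, b ∈ B}` of two sets
(infinite if one of them is empty). -/
noncomputable def setDist (A B : Set ℝ) : ℝ≥0∞ := ⨅ a ∈ A, ⨅ b ∈ B, edist a b

/-- `W` has finite propagation with respect to `E₁` and `E₂`. -/
def HasFinitePropagation (E₁ : SpectralMeasure H₁) (E₂ : SpectralMeasure H₂)
    (W : H₁ →L[ℂ] H₂) : Prop :=
  ∃ R : ℝ≥0, ∀ A₁ A₂ : Set ℝ, MeasurableSet A₁ → MeasurableSet A₂ →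
    (R : ℝ≥0∞) < setDist A₁ A₂ → E₂.proj A₂ ∘L W ∘L E₁.proj A₁ = 0

/-- `W_k = v₂(k) W v₁(-k)`. -/
noncomputable def conjugate (E₁ : SpectralMeasure H₁) (E₂ : SpectralMeasure H₂)
    (W : H₁ →L[ℂ] H₂) (k : ℝ) : H₁ →L[ℂ] H₂ :=
  E₂.waveRep k ∘L W ∘L E₁.waveRep (-k)

/-- `W` is smooth: `k ↦ W_k` is a smooth map into the bounded operators. -/
def IsSmooth (E₁ : SpectralMeasure H₁) (E₂ : SpectralMeasure H₂) (W : H₁ →L[ℂ] H₂) : Prop :=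
  ContDiff ℝ ∞ (conjugate E₁ E₂ W)

/-- `W` is uniform: `k ↦ W_k` is continuous with respect to the operator norm. -/
def IsUniform (E₁ : SpectralMeasure H₁) (E₂ : SpectralMeasure H₂) (W : H₁ →L[ℂ] H₂) : Prop :=
  Continuous (conjugate E₁ E₂ W)

end Regularity

/-! ### Quantum walks, intertwiners, similarity -/

/-- A one-dimensional (discrete-time) quantum walk on the Hilbert space `H`: a coordinate system
and a unitary operator `U`, whose powers are the representation `(U ^ t)` of `ℤ`. -/
structure QuantumWalk (H : Type*) [NormedAddCommGroup H] [InnerProductSpace ℂ H]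
    [CompleteSpace H] where
  coord : SpectralMeasure H
  U : H ≃ₗᵢ[ℂ] H

namespace QuantumWalk

variable {H₁ H₂ : Type*} [NormedAddCommGroup H₁] [InnerProductSpace ℂ H₁] [CompleteSpace H₁]
  [NormedAddCommGroup H₂] [InnerProductSpace ℂ H₂] [CompleteSpace H₂]

/-- `T U₁ = U₂ T`. -/
def IsIntertwiner (W₁ : QuantumWalk H₁) (W₂ : QuantumWalk H₂) (T : H₁ →L[ℂ] H₂) : Prop :=
  ∀ ξ : H₁, T (W₁.U ξ) = W₂.U (T ξ)

/-- Two walks are similar if there is a smooth invertible intertwiner between them. -/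
def Similar (W₁ : QuantumWalk H₁) (W₂ : QuantumWalk H₂) : Prop :=
  ∃ T : H₁ ≃L[ℂ] H₂, W₁.IsIntertwiner W₂ (T : H₁ →L[ℂ] H₂) ∧
    IsSmooth W₁.coord W₂.coord (T : H₁ →L[ℂ] H₂)

end QuantumWalk

/-! ### Model quantum walks -/

section Model

variable {H ι : Type*} [NormedAddCommGroup H] [InnerProductSpace ℂ H] [CompleteSpace H]

/-- The closed span of those basis vectors `b i` whose position `x i` lies in `A`. -/
def positionSpace (b : HilbertBasis ι ℂ H) (x : ι → ℝ) (A : Set ℝ) : Submodule ℂ H :=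
  (Submodule.span ℂ (b '' {i | x i ∈ A})).topologicalClosure

instance (b : HilbertBasis ι ℂ H) (x : ι → ℝ) (A : Set ℝ) :
    CompleteSpace (positionSpace b x A) :=
  inferInstanceAs (CompleteSpace (Submodule.span ℂ (b '' {i | x i ∈ A})).topologicalClosure)

theorem inner_starProjection (b : HilbertBasis ι ℂ H) (x : ι → ℝ) (A : Set ℝ) (ξ : H) (i : ι) :
    ⟪b i, (positionSpace b x A).starProjection ξ⟫_ℂ
      = {i | x i ∈ A}.indicator (fun i => ⟪b i, ξ⟫_ℂ) i := by
  have hsub : Submodule.span ℂ (b '' {i | x i ∈ A}) ≤ positionSpace b x A :=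
    Submodule.le_topologicalClosure _
  rw [← Submodule.inner_starProjection_left_eq_right]
  by_cases hi : x i ∈ A
  · have hm : b i ∈ positionSpace b x A := hsub (Submodule.subset_span ⟨i, hi, rfl⟩)
    rw [Submodule.starProjection_eq_self_iff.mpr hm,
      indicator_of_mem (s := {i | x i ∈ A}) hi]
  · have hm : b i ∈ (positionSpace b x A)ᗮ := by
      rw [positionSpace, Submodule.orthogonal_closure, Submodule.mem_orthogonal]
      intro u hu
      induction hu using Submodule.span_induction with
      | mem u hu =>
        obtain ⟨j, hj, rfl⟩ := hu
        exact b.orthonormal.inner_eq_zero fun hji => hi (hji ▸ hj)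
      | zero => simp
      | add u v _ _ hu hv => rw [inner_add_left, hu, hv, add_zero]
      | smul c u _ hu => rw [inner_smul_left, hu, mul_zero]
    rw [(Submodule.starProjection_apply_eq_zero_iff _).mpr hm, inner_zero_left,
      indicator_of_notMem (s := {i | x i ∈ A}) hi]

theorem hasSum_starProjection (b : HilbertBasis ι ℂ H) (x : ι → ℝ) (A : Set ℝ) (ξ : H) :
    HasSum (fun i : {i | x i ∈ A} => ⟪b i, ξ⟫_ℂ • b i)
      ((positionSpace b x A).starProjection ξ) := by
  have h := b.hasSum_repr ((positionSpace b x A).starProjection ξ)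
  simp only [HilbertBasis.repr_apply_apply, inner_starProjection] at h
  refine (hasSum_subtype_iff_indicator (f := fun i => ⟪b i, ξ⟫_ℂ • b i)).mpr ?_
  convert h using 1
  ext i
  by_cases hi : i ∈ {i | x i ∈ A} <;> simp [hi]

/-- The spectral measure of the self-adjoint operator with `b i ↦ x i • b i`: the set `A` is sent
to the orthogonal projection onto the closed span of the eigenvectors with eigenvalue in `A`. -/
noncomputable def diagonalSpectralMeasure (b : HilbertBasis ι ℂ H) (x : ι → ℝ) :
    SpectralMeasure H where
  proj A := (positionSpace b x A).starProjection
  isStarProjection_proj A _ := isStarProjection_starProjection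
  hasSum_proj_iUnion A _ hd ξ := by
    have hpre : {i | x i ∈ ⋃ n, A n} = ⋃ n, {i | x i ∈ A n} := by ext i; simp
    have h := hasSum_starProjection b x (⋃ n, A n) ξ
    have hdis : Pairwise (fun m n => Disjoint {i | x i ∈ A m} {i | x i ∈ A n}) :=
      fun m n hmn => Set.disjoint_left.mpr fun i hi hj => Set.disjoint_left.mp (hd hmn) hi hj
    rw [hpre] at h
    have h2 := (Equiv.hasSum_iff (Set.unionEqSigmaOfDisjoint hdis).symm).mpr h
    exact h2.sigma fun n => hasSum_starProjection b x (A n) ξ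
  proj_univ := by
    ext ξ
    apply b.repr.injective
    ext i
    rw [HilbertBasis.repr_apply_apply, HilbertBasis.repr_apply_apply, inner_starProjection]
    simp

/-- The Hilbert space `L²(ℝ / pℤ)`, with respect to the Haar measure of total mass `1`. -/
abbrev TorusL2 (p : ℝ) [Fact (0 < p)] : Type :=
  Lp ℂ 2 (@AddCircle.haarAddCircle p _)

/-- The coordinate system of `L²(ℝ / pℤ)` given by `(1/i) d/dk`: the function
`k ↦ exp(2π i n k / p)` is an eigenvector with eigenvalue `2π n / p`, for `n ∈ ℤ`. -/
noncomputable def torusCoord (p : ℝ) [Fact (0 < p)] : SpectralMeasure (TorusL2 p) :=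
  diagonalSpectralMeasure (fourierBasis (T := p)) (fun n : ℤ => 2 * Real.pi * n / p)

/-- The function on `ℝ / pℤ` defined by a continuous `p`-periodic function on `ℝ`. -/
def onTorus {p : ℝ} {lam : ℝ → Circle} (hc : Continuous lam) (hp : Function.Periodic lam p) :
    C(AddCircle p, Circle) where
  toFun := hp.lift
  continuous_toFun := continuous_coinduced_dom.mpr hc

theorem torus_memLp {p : ℝ} [Fact (0 < p)] (f : C(AddCircle p, Circle)) (ξ : TorusL2 p) :
    MemLp (fun k => (f k : ℂ) * ξ k) 2 AddCircle.haarAddCircle :=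
  (Lp.memLp ξ).of_le
    ((continuous_subtype_val.comp f.continuous).aestronglyMeasurable.mul (Lp.aestronglyMeasurable ξ))
    (Filter.Eventually.of_forall fun k => by rw [norm_mul, Circle.norm_coe, one_mul])

/-- Multiplication by a continuous function with values in the unit circle, as an isometry of
`L²(ℝ / pℤ)`. -/
noncomputable def mulIsometry {p : ℝ} [Fact (0 < p)] (f : C(AddCircle p, Circle)) :
    TorusL2 p →ₗᵢ[ℂ] TorusL2 p where
  toFun ξ := MemLp.toLp (fun k => (f k : ℂ) * ξ k) (torus_memLp f ξ)
  map_add' ξ η := by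
    apply Lp.ext
    filter_upwards [MemLp.coeFn_toLp (torus_memLp f (ξ + η)), MemLp.coeFn_toLp (torus_memLp f ξ),
      MemLp.coeFn_toLp (torus_memLp f η), Lp.coeFn_add ξ η,
      Lp.coeFn_add (MemLp.toLp _ (torus_memLp f ξ)) (MemLp.toLp _ (torus_memLp f η))]
      with k h1 h2 h3 h4 h5
    rw [h1, h5, Pi.add_apply, h2, h3, h4, Pi.add_apply, mul_add]
  map_smul' c ξ := by
    apply Lp.ext
    filter_upwards [MemLp.coeFn_toLp (torus_memLp f (c • ξ)), MemLp.coeFn_toLp (torus_memLp f ξ),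
      Lp.coeFn_smul c ξ, Lp.coeFn_smul c (MemLp.toLp _ (torus_memLp f ξ))] with k h1 h2 h3 h4
    rw [h1, RingHom.id_apply, h4, Pi.smul_apply, h2, h3, Pi.smul_apply, smul_eq_mul, smul_eq_mul]
    ring
  norm_map' ξ := by
    change ‖MemLp.toLp _ (torus_memLp f ξ)‖ = ‖ξ‖
    rw [Lp.norm_toLp, Lp.norm_def]
    congr 1
    exact eLpNorm_congr_norm_ae (Filter.Eventually.of_forall fun k => by rw [norm_mul, Circle.norm_coe, one_mul])

theorem coeFn_mulIsometry {p : ℝ} [Fact (0 < p)] (f : C(AddCircle p, Circle)) (ξ : TorusL2 p) :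
    mulIsometry f ξ =ᵐ[AddCircle.haarAddCircle] fun k => (f k : ℂ) * ξ k :=
  MemLp.coeFn_toLp (torus_memLp f ξ)

/-- The unitary multiplication operator `M[f] : ξ ↦ f ξ` on `L²(ℝ / pℤ)`. -/
noncomputable def mulOp {p : ℝ} [Fact (0 < p)] (f : C(AddCircle p, Circle)) :
    TorusL2 p ≃ₗᵢ[ℂ] TorusL2 p :=
  LinearIsometryEquiv.ofSurjective (mulIsometry f) (by
    intro ξ
    refine ⟨mulIsometry f⁻¹ ξ, ?_⟩
    apply Lp.ext
    filter_upwards [coeFn_mulIsometry f (mulIsometry f⁻¹ ξ), coeFn_mulIsometry f⁻¹ ξ]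
      with k h1 h2
    rw [h1, h2, ← mul_assoc, ← Circle.coe_mul, ContinuousMap.inv_apply, mul_inv_cancel,
      Circle.coe_one, one_mul])

/-- The model quantum walk `(L²(ℝ / pℤ), (M[λ] ^ t), (1/i) d/dk)`. -/
noncomputable def modelWalk {p : ℝ} [Fact (0 < p)] {lam : ℝ → Circle} (hc : Continuous lam)
    (hp : Function.Periodic lam p) : QuantumWalk (TorusL2 p) where
  coord := torusCoord p
  U := mulOp (onTorus hc hp)

end Model

/-- `p` is the minimal period of `f`: the smallest positive period. -/
def IsMinimalPeriod (f : ℝ → Circle) (p : ℝ) : Prop :=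
  IsLeast {q : ℝ | 0 < q ∧ Function.Periodic f q} p

theorem IsMinimalPeriod.periodic {f : ℝ → Circle} {p : ℝ} (h : IsMinimalPeriod f p) :
    Function.Periodic f p := h.1.2

/-- `f : ℝ → 𝕋` is real analytic, as a map into `ℂ`. -/
def IsAnalytic (f : ℝ → Circle) : Prop :=
  AnalyticOnNhd ℝ (fun k => (f k : ℂ)) univ

theorem IsAnalytic.continuous {f : ℝ → Circle} (h : IsAnalytic f) : Continuous f :=
  Continuous.subtype_mk (continuousOn_univ.mp h.continuousOn) _

end QW

set_option linter.unusedSectionVars false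

/-! A translate has the same minimal period, and translation of the circle by `-l` is then a unitary
intertwiner. It is diagonal in the Fourier basis, hence of zero propagation, and it commutes with
every `v(k)`, which is itself translation by `k`; so its conjugates are constant in `k` and it is
smooth. Thus 1 implies 2 and 3, and 3 clearly implies 4. What remains is to recover a translation
from 2 or from 4.

Both hypotheses give the same estimate: `⟪τ_k η, T τ_k ξ⟫` tends to `⟪η, T ξ⟫` as `k → 0`, uniformly
for `η`, `ξ` in the unit balls. For a uniform operator this is the definition. For finite
propagation the matrix of `T` is a band, so the pairing is a bounded trigonometric sum with
frequencies in a fixed interval, and a Bernstein inequality (`bernstein`) bounds its derivative.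

Now read `T` as a bilinear form `B(g, f) = ∫ g · T f` on continuous functions. By Stone–Weierstrass,
`B(g, h(λ₁) f) = B(h(λ₂) g, f)` for every continuous `h` on the circle, so `B` lives on the pairs
`(x, y)` with `λ₁(y) = λ₂(x)` (`exists_nullOn_of_ne`). Since `B` is almost invariant under
simultaneous translation, the velocities must agree as well: if they differ, a small translation
carries pairs with nearly equal values to pairs with separated values, where `B` vanishes
(`exists_nullOn_of_deriv_ne`).

By analyticity, unless `λ₂` is a translate of `λ₁`, first-order agreement near a pair with `λ₁'(y) ≠
0` can occur only above one value of `x` (`translate_or_isolated`). Points have measure zero and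
`λ₁` has finitely many critical points on its circle, so the `L²` bound on `B` removes these
exceptions and `B = 0` (`form_eq_zero`). A non-zero `T` therefore forces a translation. -/

namespace QW

/-! ### Bilinear forms on continuous functions intertwining two circle-valued maps -/

section Forms

variable {X Y : Type*} [TopologicalSpace X] [CompactSpace X] [MeasurableSpace X] [BorelSpace X]
  [TopologicalSpace Y] [CompactSpace Y] [MeasurableSpace Y] [BorelSpace Y]

/-- The `L²` norm of a continuous function. -/
noncomputable def l2norm (μ : Measure X) [IsFiniteMeasure μ] (f : C(X, ℂ)) : ℝ :=
  ‖ContinuousMap.toLp (E := ℂ) 2 μ ℂ f‖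

theorem l2norm_nonneg (μ : Measure X) [IsFiniteMeasure μ] (f : C(X, ℂ)) : 0 ≤ l2norm μ f :=
  norm_nonneg _

theorem l2norm_sq (μ : Measure X) [IsFiniteMeasure μ] (f : C(X, ℂ)) :
    l2norm μ f ^ 2 = ∫ x, ‖f x‖ ^ 2 ∂μ := by
  have h := ContinuousMap.inner_toLp (𝕜 := ℂ) μ f f
  rw [inner_self_eq_norm_sq_to_K] at h
  have h2 : ∀ x, f x * (starRingEnd ℂ) (f x) = ((‖f x‖ ^ 2 : ℝ) : ℂ) := fun x => by
    rw [Complex.mul_conj, Complex.normSq_eq_norm_sq]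
  simp only [h2, integral_complex_ofReal] at h
  have h3 : l2norm μ f ^ 2 = ‖ContinuousMap.toLp (E := ℂ) 2 μ ℂ f‖ ^ 2 := rfl
  rw [h3]
  exact Complex.ofReal_injective (by push_cast at h ⊢; exact h)

theorem l2norm_le (μ : Measure X) [IsFiniteMeasure μ] (f g : C(X, ℂ)) (h : ∀ x, ‖f x‖ ≤ ‖g x‖) :
    l2norm μ f ≤ l2norm μ g := by
  refine le_of_sq_le_sq ?_ (l2norm_nonneg μ g)
  rw [l2norm_sq, l2norm_sq]
  have hi : ∀ f : C(X, ℂ), Integrable (fun x => ‖f x‖ ^ 2) μ := fun f =>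
    Continuous.integrable_of_hasCompactSupport (by fun_prop) (HasCompactSupport.of_compactSpace _)
  exact integral_mono (hi f) (hi g) fun x => by have := h x; dsimp only; gcongr

theorem sum_l2norm_sq (μ : Measure X) [IsFiniteMeasure μ] {ι : Type*} [Fintype ι]
    (h : ι → C(X, ℂ)) (h1 : ∀ x, ∑ i, ‖h i x‖ ^ 2 = 1) (f : C(X, ℂ)) :
    ∑ i, l2norm μ (h i * f) ^ 2 = l2norm μ f ^ 2 := by
  simp only [l2norm_sq]
  rw [← integral_finsetSum]
  · refine integral_congr_ae (Filter.Eventually.of_forall fun x => ?_)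
    simp only [ContinuousMap.mul_apply, norm_mul, mul_pow, ← Finset.sum_mul, h1, one_mul]
  · intro i _
    exact Continuous.integrable_of_hasCompactSupport (by fun_prop)
      (HasCompactSupport.of_compactSpace _)

/-- A square partition of unity with small supports on a compact metric space. -/
theorem exists_sq_partition (S : Type*) [MetricSpace S] [CompactSpace S] {ε : ℝ} (hε : 0 < ε) :
    ∃ (t : Finset S) (h : t → C(S, ℂ)), (∑ i, h i * h i = 1) ∧ (∀ z, ∑ i, ‖h i z‖ ^ 2 = 1) ∧
      ∀ i z w, h i z ≠ 0 → h i w ≠ 0 → dist z w < ε := by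
  obtain ⟨t, ht⟩ := CompactSpace.elim_nhds_subcover (fun z : S => Metric.ball z (ε / 2))
    (fun z => Metric.ball_mem_nhds z (by positivity))
  -- Tents of radius `ε / 2`; dividing by the square root of the sum of their squares makes the
  -- squares sum to one.
  let b : t → S → ℝ := fun i z => max 0 (ε / 2 - dist z i)
  let G : S → ℝ := fun z => ∑ i, b i z ^ 2
  have hb : ∀ i, Continuous (b i) := fun i => by fun_prop
  have hG : Continuous G := by fun_prop
  have hGpos : ∀ z, 0 < G z := by
    intro z
    have hz : z ∈ ⋃ x ∈ t, Metric.ball x (ε / 2) := by rw [ht]; trivial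
    obtain ⟨i, hi, hzi⟩ := mem_iUnion₂.mp hz
    refine Finset.sum_pos' (fun _ _ => sq_nonneg _) ⟨⟨i, hi⟩, Finset.mem_univ _, ?_⟩
    have : 0 < b ⟨i, hi⟩ z := lt_max_of_lt_right (by simpa using hzi)
    positivity
  have hs : Continuous fun z => √(G z) := hG.sqrt
  have hsq : ∀ z, ∑ i, (b i z / √(G z)) ^ 2 = 1 := by
    intro z
    simp only [div_pow, Real.sq_sqrt (hGpos z).le, ← Finset.sum_div]
    exact div_self (hGpos z).ne'
  refine ⟨t, fun i => ⟨fun z => ((b i z / √(G z) : ℝ) : ℂ), Complex.continuous_ofReal.comp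
    ((hb i).div hs fun z => (Real.sqrt_pos.mpr (hGpos z)).ne')⟩, ?_, ?_, ?_⟩
  · ext z
    have := hsq z
    simp only [ContinuousMap.coe_sum, Finset.sum_apply, ContinuousMap.mul_apply,
      ContinuousMap.coe_mk, ContinuousMap.one_apply]
    simp only [sq] at this
    exact_mod_cast this
  · intro z
    simp only [ContinuousMap.coe_mk, Complex.norm_real, Real.norm_eq_abs, sq_abs]
    exact hsq z
  · intro i z w hz hw
    have key : ∀ z, ((b i z / √(G z) : ℝ) : ℂ) ≠ 0 → dist z i < ε / 2 := by
      intro z hz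
      by_contra hcon
      apply hz
      have : b i z = 0 := max_eq_left (by linarith)
      simp [this]
    have h1 := key z hz
    have h2 := key w hw
    have := dist_triangle_right z w i
    linarith

variable {μ : Measure X} [IsFiniteMeasure μ] {ν : Measure Y} [IsFiniteMeasure ν]
  {B : C(X, ℂ) →ₗ[ℂ] C(Y, ℂ) →ₗ[ℂ] ℂ} {M : ℝ}

/-- On a finite measure space the sup norm controls the `L²` norm, so the `L²` bound suffices. This
gives the limit step of the Stone–Weierstrass argument in `form_comp_mul`. -/
theorem continuous_form_right (hB : ∀ g f, ‖B g f‖ ≤ M * l2norm μ g * l2norm ν f)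
    (hM : 0 ≤ M) (g : C(X, ℂ)) : Continuous (B g) := by
  have hc : Continuous ((B g).mkContinuous
      (M * l2norm μ g * ‖ContinuousMap.toLp (E := ℂ) 2 ν ℂ‖) fun f => by
    refine (hB g f).trans ?_
    rw [mul_assoc _ ‖_‖]
    exact mul_le_mul_of_nonneg_left (ContinuousLinearMap.le_opNorm _ f)
      (mul_nonneg hM (l2norm_nonneg _ _))) := ContinuousLinearMap.continuous _
  exact hc

theorem continuous_form_left (hB : ∀ g f, ‖B g f‖ ≤ M * l2norm μ g * l2norm ν f)
    (hM : 0 ≤ M) (f : C(Y, ℂ)) : Continuous fun g => B g f :=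
  continuous_form_right (B := B.flip) (μ := ν) (ν := μ) (M := M)
    (fun f g => (hB g f).trans_eq (by ring)) hM f

/-- The values on the unit circle of a continuous function. -/
noncomputable def toPlane (L : C(X, Metric.sphere (0 : ℂ) 1)) : C(X, ℂ) := ⟨fun x => (L x : ℂ), by fun_prop⟩

theorem star_toPlane_mul (L : C(X, Metric.sphere (0 : ℂ) 1)) :
    star (toPlane L) * toPlane L = 1 := by
  ext x
  have h : ‖(L x : ℂ)‖ = 1 := by simp
  have : (starRingEnd ℂ) (L x : ℂ) * (L x : ℂ) = 1 := by
    rw [mul_comm, Complex.mul_conj, Complex.normSq_eq_norm_sq, h]; simp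
  simpa [toPlane] using this

/-- A bounded form that intertwines two circle-valued functions also intertwines their images
under a continuous function. -/
theorem form_comp_mul (hB : ∀ g f, ‖B g f‖ ≤ M * l2norm μ g * l2norm ν f) (hM : 0 ≤ M)
    {L₁ : C(Y, Metric.sphere (0 : ℂ) 1)} {L₂ : C(X, Metric.sphere (0 : ℂ) 1)}
    (hI : ∀ g f, B g (toPlane L₁ * f) = B (toPlane L₂ * g) f)
    (h : C(Metric.sphere (0 : ℂ) 1, ℂ)) :
    ∀ g f, B g (h.comp L₁ * f) = B (h.comp L₂ * g) f := by
  induction h using ContinuousMap.induction_on_of_compact with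
  | const r =>
    intro g f
    have h1 : (ContinuousMap.const (Metric.sphere (0 : ℂ) 1) r).comp L₁ * f = r • f := by
      ext; simp
    have h2 : (ContinuousMap.const (Metric.sphere (0 : ℂ) 1) r).comp L₂ * g = r • g := by
      ext; simp
    rw [h1, h2]; simp
  | id => exact hI
  | star_id =>
    intro g f
    change B g (star (toPlane L₁) * f) = B (star (toPlane L₂) * g) f
    -- On the unit circle the conjugate is the inverse, so the relation for `star` is the relation
    -- for the identity read backwards.
    have h1 : f = toPlane L₁ * (star (toPlane L₁) * f) := by
      rw [← mul_assoc, mul_comm (toPlane L₁), star_toPlane_mul, one_mul]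
    have h2 : g = toPlane L₂ * (star (toPlane L₂) * g) := by
      rw [← mul_assoc, mul_comm (toPlane L₂), star_toPlane_mul, one_mul]
    conv_rhs => rw [h1, hI, ← h2]
  | add h k hh hk =>
    intro g f
    have h1 : (h + k).comp L₁ * f = h.comp L₁ * f + k.comp L₁ * f := by ext; simp [add_mul]
    have h2 : (h + k).comp L₂ * g = h.comp L₂ * g + k.comp L₂ * g := by ext; simp [add_mul]
    rw [h1, h2, map_add, map_add, hh, hk, LinearMap.add_apply]
  | mul h k hh hk =>
    intro g f
    have h1 : (h * k).comp L₁ * f = h.comp L₁ * (k.comp L₁ * f) := by ext; simp [mul_assoc]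
    have h2 : (h * k).comp L₂ * g = k.comp L₂ * (h.comp L₂ * g) := by
      ext; simp; ring
    rw [h1, h2, hh, hk]
  | frequently h hfr =>
    intro g f
    have hcl : IsClosed {k : C(Metric.sphere (0 : ℂ) 1, ℂ) |
        B g (k.comp L₁ * f) = B (k.comp L₂ * g) f} :=
      isClosed_eq ((continuous_form_right hB hM g).comp
          ((ContinuousMap.continuous_precomp L₁).mul continuous_const))
        ((continuous_form_left hB hM f).comp
          ((ContinuousMap.continuous_precomp L₂).mul continuous_const))
    exact hcl.closure_subset (mem_closure_iff_frequently.mpr (hfr.mono fun k hk => hk g f))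

/-- A square partition of unity on the circle block-diagonalizes an intertwining form. -/
theorem form_eq_sum (hB : ∀ g f, ‖B g f‖ ≤ M * l2norm μ g * l2norm ν f) (hM : 0 ≤ M)
    {L₁ : C(Y, Metric.sphere (0 : ℂ) 1)} {L₂ : C(X, Metric.sphere (0 : ℂ) 1)}
    (hI : ∀ g f, B g (toPlane L₁ * f) = B (toPlane L₂ * g) f) {ι : Type*} [Fintype ι]
    (h : ι → C(Metric.sphere (0 : ℂ) 1, ℂ)) (h1 : ∑ i, h i * h i = 1)
    (g : C(X, ℂ)) (f : C(Y, ℂ)) :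
    B g f = ∑ i, B ((h i).comp L₂ * g) ((h i).comp L₁ * f) := by
  -- Of the two factors `h i`, one stays with `f` and the other is moved over to `g`; this is why
  -- the squares form the partition.
  have hf : f = ∑ i, (h i).comp L₁ * ((h i).comp L₁ * f) := by
    ext y
    have := DFunLike.congr_fun h1 (L₁ y)
    simp only [ContinuousMap.coe_sum, Finset.sum_apply, ContinuousMap.mul_apply,
      ContinuousMap.one_apply, ContinuousMap.comp_apply] at this ⊢
    simp only [← mul_assoc, ← Finset.sum_mul, this, one_mul]
  conv_lhs => rw [hf, map_sum]
  exact Finset.sum_congr rfl fun i _ => form_comp_mul hB hM hI (h i) _ _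

/-- An intertwining form vanishes on functions whose supports have separated values. -/
theorem form_eq_zero_of_separated (hB : ∀ g f, ‖B g f‖ ≤ M * l2norm μ g * l2norm ν f)
    (hM : 0 ≤ M) {L₁ : C(Y, Metric.sphere (0 : ℂ) 1)} {L₂ : C(X, Metric.sphere (0 : ℂ) 1)}
    (hI : ∀ g f, B g (toPlane L₁ * f) = B (toPlane L₂ * g) f) {c : ℝ} (hc : 0 < c)
    (g : C(X, ℂ)) (f : C(Y, ℂ))
    (hgf : ∀ x y, g x ≠ 0 → f y ≠ 0 → c ≤ dist (L₁ y) (L₂ x)) : B g f = 0 := by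
  -- At scale `c` no `h i` can be non-zero both at a value of `L₁` on the support of `f` and at a
  -- value of `L₂` on the support of `g`.
  obtain ⟨t, h, h1, -, h3⟩ := exists_sq_partition (Metric.sphere (0 : ℂ) 1) hc
  rw [form_eq_sum hB hM hI h h1]
  refine Finset.sum_eq_zero fun i _ => ?_
  by_cases hz : (h i).comp L₂ * g = 0
  · rw [hz]; simp
  obtain ⟨x, hx⟩ : ∃ x, ((h i).comp L₂ * g) x ≠ 0 := by
    by_contra hcon
    push Not at hcon
    exact hz (ContinuousMap.ext hcon)
  have hf : (h i).comp L₁ * f = 0 := by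
    ext y
    by_contra hy
    simp only [ContinuousMap.mul_apply, ContinuousMap.comp_apply, ContinuousMap.zero_apply,
      mul_eq_zero, not_or, ne_eq] at hx hy
    exact (h3 i _ _ hy.1 hx.1).not_ge (hgf x y hx.2 hy.2)
  rw [hf, map_zero]

/-! ### From local to global vanishing of a form -/

/-- The form vanishes on pairs of functions supported in `U` and `V`. -/
def NullOn (B : C(X, ℂ) →ₗ[ℂ] C(Y, ℂ) →ₗ[ℂ] ℂ) (U : Set X) (V : Set Y) : Prop :=
  ∀ g f, (∀ x, x ∉ U → g x = 0) → (∀ y, y ∉ V → f y = 0) → B g f = 0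

theorem NullOn.mono {U U' : Set X} {V V' : Set Y} (h : NullOn B U V) (hU : U' ⊆ U)
    (hV : V' ⊆ V) : NullOn B U' V' :=
  fun g f hg hf => h g f (fun x hx => hg x fun h' => hx (hU h')) fun y hy => hf y fun h' => hy (hV h')

theorem map_eq_zero_of_cover {X M : Type*} [TopologicalSpace X] [CompactSpace X] [T2Space X]
    [AddCommGroup M] [Module ℂ M]
    (l : C(X, ℂ) →ₗ[ℂ] M) {K : Set X} (hK : IsCompact K) {ι : Type*} (t : Finset ι)
    {U : ι → Set X} (hU : ∀ i, IsOpen (U i)) (hKU : K ⊆ ⋃ i ∈ t, U i)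
    (hl : ∀ i ∈ t, ∀ f, (∀ x, x ∉ U i → f x = 0) → l f = 0)
    (f : C(X, ℂ)) (hf : ∀ x, x ∉ K → f x = 0) : l f = 0 := by
  let e := t.equivFin
  obtain ⟨χ, h1, h2, -, -⟩ := exists_continuous_sum_one_of_isOpen_isCompact
    (s := fun j => U (e.symm j)) (fun j => hU _) hK (by
      intro x hx
      obtain ⟨i, hi, hxi⟩ := mem_iUnion₂.mp (hKU hx)
      exact mem_iUnion.mpr ⟨e ⟨i, hi⟩, by simpa using hxi⟩)
  let c : C(ℝ, ℂ) := ⟨Complex.ofReal, Complex.continuous_ofReal⟩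
  have hsum : f = ∑ j, c.comp (χ j) * f := by
    ext x
    by_cases hx : x ∈ K
    · have := h2 hx
      simp only [Finset.sum_apply, Pi.one_apply] at this
      simp only [ContinuousMap.coe_sum, Finset.sum_apply, ContinuousMap.mul_apply,
        ContinuousMap.comp_apply, ← Finset.sum_mul]
      have h3 : ∑ j, c (χ j x) = 1 := by
        change ∑ j, ((χ j x : ℝ) : ℂ) = 1
        exact_mod_cast this
      rw [h3, one_mul]
    · simp [hf x hx]
  rw [hsum, map_sum]
  refine Finset.sum_eq_zero fun j _ => hl (e.symm j) (e.symm j).2 _ fun x hx => ?_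
  have : χ j x = 0 := by
    by_contra hne
    exact hx (h1 j (subset_tsupport _ hne))
  simp [this, c]

/-- The tube-lemma argument: for fixed `x`, finitely many neighbourhoods cover `K'` and their
partners around `x` are intersected; then finitely many `x` suffice. Each time a partition of unity
splits one argument of the form. -/
theorem nullOn_of_isCompact [T2Space X] [T2Space Y] {K : Set X} {K' : Set Y} (hK : IsCompact K)
    (hK' : IsCompact K') (h : ∀ x ∈ K, ∀ y ∈ K', ∃ U ∈ nhds x, ∃ V ∈ nhds y, NullOn B U V) :
    NullOn B K K' := by
  have step : ∀ x ∈ K, ∃ U, IsOpen U ∧ x ∈ U ∧ NullOn B U K' := by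
    intro x hx
    have hV : ∀ y ∈ K', ∃ U V, IsOpen U ∧ x ∈ U ∧ IsOpen V ∧ y ∈ V ∧ NullOn B U V := by
      intro y hy
      obtain ⟨U, hU, V, hV, hn⟩ := h x hx y hy
      obtain ⟨U', hU', hUo, hxU⟩ := mem_nhds_iff.mp hU
      obtain ⟨V', hV', hVo, hyV⟩ := mem_nhds_iff.mp hV
      exact ⟨U', V', hUo, hxU, hVo, hyV, hn.mono hU' hV'⟩
    choose! U V hUo hxU hVo hyV hn using hV
    obtain ⟨t, ht, hcov⟩ := hK'.elim_nhds_subcover V fun y hy => (hVo y hy).mem_nhds (hyV y hy)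
    refine ⟨⋂ y ∈ t, U y, isOpen_biInter_finset fun y hy => hUo y (ht y hy),
      mem_iInter₂.mpr fun y hy => hxU y (ht y hy), fun g f hg hf => ?_⟩
    refine map_eq_zero_of_cover (B g) hK' (t.attach) (U := fun y => V y)
      (fun y => hVo _ (ht y y.2)) (by simpa [iUnion_subtype] using hcov) ?_ f hf
    intro y _ f' hf'
    exact hn y (ht y y.2) g f' (fun z hz => hg z fun h' => hz (mem_iInter₂.mp h' y y.2)) hf'
  choose! U hUo hxU hn using step
  obtain ⟨t, ht, hcov⟩ := hK.elim_nhds_subcover U fun x hx => (hUo x hx).mem_nhds (hxU x hx)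
  intro g f hg hf
  refine map_eq_zero_of_cover (B.flip f) hK (t.attach) (U := fun x => U x)
    (fun x => hUo _ (ht x x.2)) (by simpa [iUnion_subtype] using hcov) ?_ g hg
  intro x _ g' hg'
  exact hn x (ht x x.2) g' f hg' hf

/-- A continuous function vanishing almost everywhere off an open set is an `L²` limit of
functions with compact support in this set. -/
theorem exists_tendsto_of_ae {X : Type*} [MetricSpace X] [CompactSpace X] [MeasurableSpace X]
    [BorelSpace X] (μ : Measure X) [IsFiniteMeasure μ] {W : Set X} (hW : IsOpen W) (f : C(X, ℂ))
    (hf : ∀ᵐ x ∂μ, x ∉ W → f x = 0) : ∃ F : ℕ → C(X, ℂ),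
      (∀ n, ∃ K, IsCompact K ∧ K ⊆ W ∧ ∀ x, x ∉ K → F n x = 0) ∧
      Filter.Tendsto (fun n => l2norm μ (F n - f)) Filter.atTop (nhds 0) := by
  -- `Metric.infDist` to the empty set is `0`, so the cutoffs below would vanish identically when
  -- `W` is the whole space.
  by_cases hne : Wᶜ.Nonempty
  swap
  · rw [not_nonempty_iff_eq_empty, compl_empty_iff] at hne
    exact ⟨fun _ => f, fun _ => ⟨univ, isCompact_univ, hne.ge, by simp⟩, by simp [l2norm]⟩
  -- The cutoff is `0` up to distance `1 / n` from the complement of `W` and `1` from distance `2 /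
  -- n` on.
  let χ : ℕ → C(X, ℝ) := fun n =>
    ⟨fun x => min 1 (max 0 (n * Metric.infDist x Wᶜ - 1)), by fun_prop⟩
  let c : C(ℝ, ℂ) := ⟨Complex.ofReal, Complex.continuous_ofReal⟩
  have h01 : ∀ n x, 0 ≤ χ n x ∧ χ n x ≤ 1 := fun n x =>
    ⟨le_min zero_le_one (le_max_left _ _), min_le_left _ _⟩
  refine ⟨fun n => c.comp (χ n) * f, fun n => ⟨{x | 1 ≤ n * Metric.infDist x Wᶜ}, ?_, ?_, ?_⟩, ?_⟩
  · exact (isClosed_le (by fun_prop) (by fun_prop)).isCompact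
  · intro x hx
    by_contra hxW
    have : Metric.infDist x Wᶜ = 0 := Metric.infDist_zero_of_mem hxW
    simp only [mem_ofPred_eq, this] at hx
    norm_num at hx
  · intro x hx
    have : χ n x = 0 := by
      simp only [mem_ofPred_eq, not_le] at hx
      change min 1 (max 0 (n * Metric.infDist x Wᶜ - 1)) = 0
      rw [max_eq_left (by linarith)]; simp
    simp [this, c]
  · have hsq : Filter.Tendsto (fun n => l2norm μ (c.comp (χ n) * f - f) ^ 2) Filter.atTop
        (nhds 0) := by
      simp only [l2norm_sq]
      have h0 : (0 : ℝ) = ∫ x, (0 : ℝ) ∂μ := by simp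
      rw [h0]
      refine tendsto_integral_of_dominated_convergence (fun x => ‖f x‖ ^ 2) ?_ ?_ ?_ ?_
      · intro n
        exact Continuous.aestronglyMeasurable (by fun_prop)
      · exact Continuous.integrable_of_hasCompactSupport (by fun_prop)
          (HasCompactSupport.of_compactSpace _)
      · intro n
        refine Filter.Eventually.of_forall fun x => ?_
        rw [Real.norm_of_nonneg (by positivity)]
        have h1 : (c.comp (χ n) * f - f) x = ((χ n x - 1 : ℝ) : ℂ) * f x := by
          change ((χ n x : ℝ) : ℂ) * f x - f x = _
          push_cast; ring
        rw [h1, norm_mul, Complex.norm_real, mul_pow]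
        have h2 := h01 n x
        have h3 : ‖χ n x - 1‖ ≤ 1 := by rw [Real.norm_eq_abs, abs_le]; constructor <;> linarith
        exact mul_le_of_le_one_left (by positivity) (pow_le_one₀ (norm_nonneg _) h3)
      · filter_upwards [hf] with x hx
        by_cases hxW : x ∈ W
        · have hpos : 0 < Metric.infDist x Wᶜ :=
            (hW.isClosed_compl.notMem_iff_infDist_pos hne).mp (by simpa using hxW)
          obtain ⟨N, hN⟩ := exists_nat_gt (2 / Metric.infDist x Wᶜ)
          rw [div_lt_iff₀ hpos] at hN
          refine tendsto_const_nhds.congr' ?_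
          filter_upwards [Filter.eventually_ge_atTop N] with n hn
          have h1 : χ n x = 1 := by
            have : (N : ℝ) * Metric.infDist x Wᶜ ≤ n * Metric.infDist x Wᶜ := by gcongr
            exact min_eq_left (le_max_of_le_right (by linarith))
          simp [h1, c]
        · simp [hx hxW]
    have := hsq.sqrt
    simpa [Real.sqrt_sq (l2norm_nonneg _ _)] using this

/-- Compactly supported functions in `W` and `W'` are handled by `nullOn_of_isCompact`, and the `L²`
bound passes to the limit. Since `g` and `f` need to vanish only almost everywhere off `W` and `W'`,
null sets may be deleted from these; this is how exceptional points are discarded later. -/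
theorem form_eq_zero_of_locally_null {X Y : Type*} [MetricSpace X] [CompactSpace X]
    [MeasurableSpace X] [BorelSpace X] [MetricSpace Y] [CompactSpace Y]
    [MeasurableSpace Y] [BorelSpace Y] {μ : Measure X} [IsFiniteMeasure μ] {ν : Measure Y}
    [IsFiniteMeasure ν] {B : C(X, ℂ) →ₗ[ℂ] C(Y, ℂ) →ₗ[ℂ] ℂ} {M : ℝ}
    (hB : ∀ g f, ‖B g f‖ ≤ M * l2norm μ g * l2norm ν f)
    {W : Set X} {W' : Set Y} (hW : IsOpen W) (hW' : IsOpen W')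
    (h : ∀ x ∈ W, ∀ y ∈ W', ∃ U ∈ nhds x, ∃ V ∈ nhds y, NullOn B U V) (g : C(X, ℂ)) (f : C(Y, ℂ))
    (hg : ∀ᵐ x ∂μ, x ∉ W → g x = 0) (hf : ∀ᵐ y ∂ν, y ∉ W' → f y = 0) : B g f = 0 := by
  obtain ⟨G, hG, hGt⟩ := exists_tendsto_of_ae μ hW g hg
  obtain ⟨F, hF, hFt⟩ := exists_tendsto_of_ae ν hW' f hf
  have h0 : ∀ m n, B (G m) (F n) = 0 := by
    intro m n
    obtain ⟨K, hK, hKW, hKs⟩ := hG m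
    obtain ⟨K', hK', hKW', hKs'⟩ := hF n
    exact nullOn_of_isCompact hK hK' (fun x hx y hy => h x (hKW hx) y (hKW' hy)) _ _ hKs hKs'
  have h1 : ∀ m, B (G m) f = 0 := by
    intro m
    have hb : ∀ n, ‖B (G m) f‖ ≤ M * l2norm μ (G m) * l2norm ν (F n - f) := fun n => by
      have := hB (G m) (F n - f)
      rwa [map_sub, h0, zero_sub, norm_neg] at this
    have := ge_of_tendsto' (hFt.const_mul (M * l2norm μ (G m))) hb
    rw [mul_zero] at this
    exact norm_le_zero_iff.mp this
  have hb : ∀ n, ‖B g f‖ ≤ M * l2norm μ (G n - g) * l2norm ν f := fun n => by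
    have := hB (G n - g) f
    rwa [map_sub, LinearMap.sub_apply, h1, zero_sub, norm_neg] at this
  have := ge_of_tendsto' ((hGt.const_mul M).mul_const (l2norm ν f)) hb
  rw [mul_zero, zero_mul] at this
  exact norm_le_zero_iff.mp this

end Forms
-- Local vanishing where values or derivatives disagree
/-- Translation by `k` of a function on the circle of length `p`. -/
noncomputable def shift {p : ℝ} (k : ℝ) (f : C(AddCircle p, ℂ)) : C(AddCircle p, ℂ) :=
  ⟨fun x => f (x + (k : AddCircle p)), by fun_prop⟩

theorem shift_apply {p : ℝ} (k : ℝ) (f : C(AddCircle p, ℂ)) (x : AddCircle p) :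
    shift k f x = f (x + (k : AddCircle p)) := rfl

theorem coe_image_ball_mem_nhds (p a : ℝ) {r : ℝ} (hr : 0 < r) :
    ((↑) : ℝ → AddCircle p) '' Metric.ball a r ∈ nhds (a : AddCircle p) :=
  QuotientAddGroup.isOpenMap_coe.image_mem_nhds (Metric.ball_mem_nhds a hr)

/-- Strict differentiability makes the linear approximation uniform in the base point `x` near `a`,
which is needed because the supports are whole neighbourhoods. -/
theorem exists_increment_bound {f : ℝ → ℂ} {d : ℂ} {a : ℝ} (hf : HasStrictDerivAt f d a) {c : ℝ}
    (hc : 0 < c) : ∃ r > 0, ∀ x k : ℝ, |x - a| < r → |k| < r →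
      ‖f (x + k) - f x - k * d‖ ≤ c * |k| := by
  have h := hf.hasStrictFDerivAt.isLittleO.def hc
  obtain ⟨r, hr, hball⟩ := Metric.eventually_nhds_iff_ball.mp h
  refine ⟨r / 2, by positivity, fun x k hx hk => ?_⟩
  have := hball (x + k, x) (by
    rw [Metric.mem_ball, Prod.dist_eq, max_lt_iff, Real.dist_eq, Real.dist_eq]
    constructor
    · have := abs_add_le (x - a) k
      have e : x + k - a = x - a + k := by ring
      dsimp only
      rw [e]; linarith
    · dsimp only; linarith)
  simpa using this

theorem eq_zero_of_forall_norm_le_mul {z : ℂ} {C : ℝ} (h : ∀ ε > 0, ‖z‖ ≤ ε * C) : z = 0 := by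
  have ht : Filter.Tendsto (fun ε : ℝ => ε * C) (nhdsWithin 0 (Ioi 0)) (nhds 0) := by
    have : Filter.Tendsto (fun ε : ℝ => ε * C) (nhds 0) (nhds (0 * C)) :=
      (continuous_id.mul continuous_const).tendsto 0
    rw [zero_mul] at this
    exact this.mono_left nhdsWithin_le_nhds
  exact norm_le_zero_iff.mp (ge_of_tendsto ht
    (Filter.eventually_of_mem self_mem_nhdsWithin fun ε hε => h ε hε))

section Local

variable {p₁ p₂ : ℝ} [Fact (0 < p₁)] [Fact (0 < p₂)]
  {μ : Measure (AddCircle p₂)} [IsFiniteMeasure μ] {ν : Measure (AddCircle p₁)} [IsFiniteMeasure ν]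
  {B : C(AddCircle p₂, ℂ) →ₗ[ℂ] C(AddCircle p₁, ℂ) →ₗ[ℂ] ℂ} {M : ℝ}
  {L₁ : C(AddCircle p₁, Metric.sphere (0 : ℂ) 1)} {L₂ : C(AddCircle p₂, Metric.sphere (0 : ℂ) 1)}
  {f₁ f₂ : ℝ → ℂ} {a₁ a₂ : ℝ}

/-- Where the values of the two functions differ, an intertwining form vanishes. -/
theorem exists_nullOn_of_ne (hB : ∀ g f, ‖B g f‖ ≤ M * l2norm μ g * l2norm ν f) (hM : 0 ≤ M)
    (hI : ∀ g f, B g (toPlane L₁ * f) = B (toPlane L₂ * g) f)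
    {x : AddCircle p₂} {y : AddCircle p₁} (hne : L₁ y ≠ L₂ x) :
    ∃ U ∈ nhds x, ∃ V ∈ nhds y, NullOn B U V := by
  have hd : 0 < dist (L₁ y) (L₂ x) := dist_pos.mpr hne
  set d := dist (L₁ y) (L₂ x)
  refine ⟨{x' | dist (L₂ x') (L₂ x) < d / 3}, ?_, {y' | dist (L₁ y') (L₁ y) < d / 3}, ?_, ?_⟩
  · exact (isOpen_lt (by fun_prop) continuous_const).mem_nhds (by simp; positivity)
  · exact (isOpen_lt (by fun_prop) continuous_const).mem_nhds (by simp; positivity)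
  intro g f hg hf
  refine form_eq_zero_of_separated hB hM hI (c := d / 3) (by positivity) g f fun x' y' hx' hy' => ?_
  have h1 : dist (L₂ x') (L₂ x) < d / 3 := by
    by_contra h; exact hx' (hg x' h)
  have h2 : dist (L₁ y') (L₁ y) < d / 3 := by
    by_contra h; exact hy' (hf y' h)
  have h3 := dist_triangle4 (L₁ y) (L₁ y') (L₂ x') (L₂ x)
  rw [dist_comm (L₁ y) (L₁ y')] at h3
  change d ≤ _ at h3
  linarith

/-- Where the derivatives of the two functions differ, an intertwining form that depends
continuously on simultaneous translations vanishes. -/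
theorem exists_nullOn_of_deriv_ne (hB : ∀ g f, ‖B g f‖ ≤ M * l2norm μ g * l2norm ν f) (hM : 0 ≤ M)
    (hI : ∀ g f, B g (toPlane L₁ * f) = B (toPlane L₂ * g) f)
    (hU : ∀ ε > 0, ∃ δ > 0, ∀ k : ℝ, |k| < δ → ∀ g f,
      ‖B (shift k g) (shift k f) - B g f‖ ≤ ε * l2norm μ g * l2norm ν f)
    (hf₁ : ∀ x : ℝ, (L₁ x : ℂ) = f₁ x) (hf₂ : ∀ x : ℝ, (L₂ x : ℂ) = f₂ x) {d₁ d₂ : ℂ}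
    (hd₁ : HasStrictDerivAt f₁ d₁ a₁) (hd₂ : HasStrictDerivAt f₂ d₂ a₂) (hne : d₁ ≠ d₂) :
    ∃ U ∈ nhds (a₂ : AddCircle p₂), ∃ V ∈ nhds (a₁ : AddCircle p₁), NullOn B U V := by
  have hD : 0 < ‖d₁ - d₂‖ := norm_pos_iff.mpr (sub_ne_zero.mpr hne)
  set D := ‖d₁ - d₂‖
  -- The radii are fixed before `ε`, so that the neighbourhoods do not shrink with it; only the step
  -- `k` and the partition depend on `ε`.
  obtain ⟨r₁, hr₁, h₁⟩ := exists_increment_bound hd₁ (c := D / 8) (by positivity)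
  obtain ⟨r₂, hr₂, h₂⟩ := exists_increment_bound hd₂ (c := D / 8) (by positivity)
  refine ⟨_, coe_image_ball_mem_nhds p₂ a₂ hr₂, _, coe_image_ball_mem_nhds p₁ a₁ hr₁, ?_⟩
  intro g f hg hf
  refine eq_zero_of_forall_norm_le_mul (C := l2norm μ g * l2norm ν f) fun ε hε => ?_
  obtain ⟨δ, hδ, hδU⟩ := hU ε hε
  obtain ⟨k, hk0, hk⟩ := exists_between (lt_min hδ (lt_min hr₁ hr₂))
  obtain ⟨hkδ, hkr₁, hkr₂⟩ : k < δ ∧ k < r₁ ∧ k < r₂ := by simpa using hk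
  have hkabs : |k| = k := abs_of_pos hk0
  -- Within a block the values differ by less than `k D / 4`. Translation by `k` changes the
  -- difference by `k (d₁ - d₂)`, of norm `k D`, up to two errors of `k D / 8`; afterwards the
  -- values are at least `k D / 2` apart, more than the `k D / 4` required.
  obtain ⟨t, h, hs1, hs2, hs3⟩ := exists_sq_partition (Metric.sphere (0 : ℂ) 1)
    (ε := k * D / 4) (by positivity)
  have hzero : ∀ i, B (shift (-k) ((h i).comp L₂ * g)) (shift (-k) ((h i).comp L₁ * f)) = 0 := by
    intro i
    refine form_eq_zero_of_separated hB hM hI (c := k * D / 4) (by positivity) _ _ ?_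
    intro x y hx hy
    simp only [shift_apply, ContinuousMap.mul_apply, ContinuousMap.comp_apply, ne_eq, mul_eq_zero,
      not_or] at hx hy
    obtain ⟨s, hs, hsx⟩ : x + ((-k : ℝ) : AddCircle p₂) ∈
        ((↑) : ℝ → AddCircle p₂) '' Metric.ball a₂ r₂ := by
      by_contra hcon; exact hx.2 (hg _ hcon)
    obtain ⟨u, hu, huy⟩ : y + ((-k : ℝ) : AddCircle p₁) ∈
        ((↑) : ℝ → AddCircle p₁) '' Metric.ball a₁ r₁ := by
      by_contra hcon; exact hy.2 (hf _ hcon)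
    have ex : x = ((s + k : ℝ) : AddCircle p₂) := by
      rw [AddCircle.coe_add, hsx, AddCircle.coe_neg]; abel
    have ey : y = ((u + k : ℝ) : AddCircle p₁) := by
      rw [AddCircle.coe_add, huy, AddCircle.coe_neg]; abel
    have hsm := hs3 i _ _ hy.1 hx.1
    rw [← hsx, ← huy, Subtype.dist_eq, hf₁, hf₂, dist_eq_norm] at hsm
    rw [ex, ey, Subtype.dist_eq, hf₁, hf₂, dist_eq_norm]
    have e₁ := h₁ u k (by simpa [Real.dist_eq] using hu) (by rwa [hkabs])
    have e₂ := h₂ s k (by simpa [Real.dist_eq] using hs) (by rwa [hkabs])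
    rw [hkabs] at e₁ e₂
    have hkD : ‖(k : ℂ) * (d₁ - d₂)‖ = k * D := by
      rw [norm_mul, Complex.norm_real, Real.norm_of_nonneg hk0.le]
    have hdec : (k : ℂ) * (d₁ - d₂) = (f₁ (u + k) - f₂ (s + k)) - (f₁ u - f₂ s)
        - (f₁ (u + k) - f₁ u - k * d₁) + (f₂ (s + k) - f₂ s - k * d₂) := by ring
    rw [hdec] at hkD
    have n1 := norm_add_le ((f₁ (u + k) - f₂ (s + k)) - (f₁ u - f₂ s)
        - (f₁ (u + k) - f₁ u - k * d₁)) (f₂ (s + k) - f₂ s - k * d₂)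
    have n2 := norm_sub_le ((f₁ (u + k) - f₂ (s + k)) - (f₁ u - f₂ s))
        (f₁ (u + k) - f₁ u - k * d₁)
    have n3 := norm_sub_le (f₁ (u + k) - f₂ (s + k)) (f₁ u - f₂ s)
    have : 0 < k * D := by positivity
    linarith
  have hterm : ∀ i, ‖B ((h i).comp L₂ * g) ((h i).comp L₁ * f)‖
      ≤ ε * (l2norm μ ((h i).comp L₂ * g) * l2norm ν ((h i).comp L₁ * f)) := by
    intro i
    have := hδU (-k) (by rwa [abs_neg, hkabs]) ((h i).comp L₂ * g) ((h i).comp L₁ * f)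
    rwa [hzero, zero_sub, norm_neg, mul_assoc] at this
  rw [form_eq_sum hB hM hI h hs1]
  refine (norm_sum_le _ _).trans ((Finset.sum_le_sum fun i _ => hterm i).trans ?_)
  rw [← Finset.mul_sum]
  refine mul_le_mul_of_nonneg_left ?_ hε.le
  -- Cauchy–Schwarz over the blocks: since the squares of the `h i` sum to one, the bound does not
  -- depend on the number of blocks, which grows as `k → 0`.
  refine le_of_sq_le_sq ?_ (mul_nonneg (l2norm_nonneg μ g) (l2norm_nonneg ν f))
  refine (Finset.sum_mul_sq_le_sq_mul_sq _ _ _).trans_eq ?_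
  rw [sum_l2norm_sq μ (fun i => (h i).comp L₂) (fun x => hs2 _),
    sum_l2norm_sq ν (fun i => (h i).comp L₁) (fun x => hs2 _), mul_pow]

end Local

/-! ### First-order contact of analytic curves -/

/-- Two analytic curves that meet at two parameters, the first with non-zero velocity, either
differ by a translation of the parameter or do not agree to first order at nearby parameters. -/
theorem translate_or_isolated {f₁ f₂ : ℝ → ℂ} (h₁ : AnalyticOnNhd ℝ f₁ univ)
    (h₂ : AnalyticOnNhd ℝ f₂ univ) {a₁ a₂ : ℝ} (hv : f₁ a₁ = f₂ a₂)
    (hne : deriv f₁ a₁ ≠ 0) :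
    (∀ x, f₂ x = f₁ (x + (a₁ - a₂))) ∨ ∃ r > 0, ∀ x ∈ Metric.ball a₂ r, x ≠ a₂ →
      ∀ y ∈ Metric.ball a₁ r, ¬ (f₁ y = f₂ x ∧ deriv f₁ y = deriv f₂ x) := by
  set d := deriv f₁ a₁ 
  -- Projection onto the direction of the velocity `d`: it turns `f₁` into a real function that is
  -- locally invertible at `a₁`.
  let π : ℂ →L[ℝ] ℝ := Complex.reCLM.comp (ContinuousLinearMap.mul ℝ ℂ ((starRingEnd ℂ) d))
  have hπd : π d ≠ 0 := by
    have : π d = ‖d‖ ^ 2 := by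
      change ((starRingEnd ℂ) d * d).re = _
      rw [mul_comm, Complex.mul_conj, Complex.normSq_eq_norm_sq, Complex.ofReal_re]
    rw [this]; positivity
  have hu : ∀ f : ℝ → ℂ, AnalyticOnNhd ℝ f univ → ∀ x, AnalyticAt ℝ (fun t => π (f t)) x :=
    fun f hf x => (π.analyticAt _).comp (hf x (mem_univ x))
  have hu' : deriv (fun t => π (f₁ t)) a₁ = π d :=
    (π.hasFDerivAt.comp_hasDerivAt a₁ (h₁ a₁ (mem_univ _)).differentiableAt.hasDerivAt).deriv
  have hne' : deriv (fun t => π (f₁ t)) a₁ ≠ 0 := by rwa [hu']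
  let ρ := (hu f₁ h₁ a₁).hasStrictDerivAt.localInverse _ _ _ hne'
  have hρan : AnalyticAt ℝ ρ (π (f₁ a₁)) := (hu f₁ h₁ a₁).analyticAt_localInverse hne'
  have hρl : ∀ᶠ y in nhds a₁, ρ (π (f₁ y)) = y :=
    HasStrictDerivAt.eventually_left_inverse (hu f₁ h₁ a₁).hasStrictDerivAt hne'
  -- The only possible `y` near `a₁` with `f₁ y = f₂ x` is `φ x`, so contact of the curves becomes
  -- the vanishing of analytic functions of `x` alone.
  let φ : ℝ → ℝ := fun x => ρ (π (f₂ x))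
  have hφa : φ a₂ = a₁ := by
    change ρ (π (f₂ a₂)) = a₁
    rw [← hv]; exact hρl.self_of_nhds
  have hφ : AnalyticAt ℝ φ a₂ := by
    rw [hv] at hρan
    exact AnalyticAt.comp (g := ρ) (f := fun t => π (f₂ t)) hρan (hu f₂ h₂ a₂)
  have isolated : ∀ P : ℝ → Prop, (∀ᶠ x in nhdsWithin a₂ {a₂}ᶜ, P x) →
      (∀ x, P x → ¬ (f₁ (φ x) = f₂ x ∧ deriv f₁ (φ x) = deriv f₂ x)) →
      ∃ r > 0, ∀ x ∈ Metric.ball a₂ r, x ≠ a₂ →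
      ∀ y ∈ Metric.ball a₁ r, ¬ (f₁ y = f₂ x ∧ deriv f₁ y = deriv f₂ x) := by
    intro P hP hPn
    rw [eventually_nhdsWithin_iff] at hP
    obtain ⟨r₁, hr₁, hb₁⟩ := Metric.eventually_nhds_iff_ball.mp hP
    obtain ⟨r₂, hr₂, hb₂⟩ := Metric.eventually_nhds_iff_ball.mp hρl
    refine ⟨min r₁ r₂, lt_min hr₁ hr₂, fun x hx hxa y hy hbad => ?_⟩
    have hy' : φ x = y := by
      change ρ (π (f₂ x)) = y
      rw [← hbad.1]
      exact hb₂ y (Metric.ball_subset_ball (min_le_right _ _) hy)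
    refine hPn x (hb₁ x (Metric.ball_subset_ball (min_le_left _ _) hx) hxa) ?_
    rwa [hy']
  have hf1φ : AnalyticAt ℝ (fun x => f₁ (φ x)) a₂ := (h₁ _ (mem_univ _)).comp hφ
  have hf1'φ : AnalyticAt ℝ (fun x => deriv f₁ (φ x)) a₂ := (h₁.deriv _ (mem_univ _)).comp hφ
  rcases (hf1φ.sub (h₂ a₂ (mem_univ _))).eventually_eq_zero_or_eventually_ne_zero with h0 | h0
  swap
  · exact Or.inr (isolated _ h0 fun x hx hb => hx (sub_eq_zero.mpr hb.1))
  rcases (hf1'φ.sub (h₂.deriv a₂ (mem_univ _))).eventually_eq_zero_or_eventually_ne_zero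
    with h0' | h0'
  swap
  · exact Or.inr (isolated _ h0' fun x hx hb => hx (sub_eq_zero.mpr hb.2))
  -- Here `f₁ ∘ φ = f₂` and `f₁' ∘ φ = f₂'` near `a₂`. Differentiating the first gives `φ' = 1`, so
  -- `φ` is a translation near `a₂`; the identity theorem does the rest.
  left
  have hnz : ∀ᶠ x in nhds a₂, deriv f₁ (φ x) ≠ 0 :=
    hf1'φ.continuousAt.eventually_ne (by rw [hφa]; exact hne)
  have hφ' : ∀ᶠ x in nhds a₂, HasDerivAt φ 1 x := by
    filter_upwards [h0.eventually_nhds, h0', hnz, hφ.eventually_analyticAt] with x e1 e2 e3 e4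
    have hc : HasDerivAt (fun t => f₁ (φ t)) (deriv φ x • deriv f₁ (φ x)) x :=
      (h₁ _ (mem_univ _)).differentiableAt.hasDerivAt.scomp x e4.differentiableAt.hasDerivAt
    have he : (fun t => f₁ (φ t)) =ᶠ[nhds x] f₂ := e1.mono fun t ht => sub_eq_zero.mp ht
    have h3 : deriv φ x • deriv f₁ (φ x) = deriv f₁ (φ x) := by
      rw [← hc.deriv, he.deriv_eq]
      exact (sub_eq_zero.mp e2).symm
    have h4 : deriv φ x = 1 := by
      have h5 : (deriv φ x - 1) • deriv f₁ (φ x) = 0 := by rw [sub_smul, h3, one_smul, sub_self]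
      have := (smul_eq_zero.mp h5).resolve_right e3
      linarith
    rw [← h4]; exact e4.differentiableAt.hasDerivAt
  have hφx : ∀ᶠ x in nhds a₂, φ x = x + (a₁ - a₂) := by
    obtain ⟨r, hr, hb⟩ := Metric.eventually_nhds_iff_ball.mp hφ'
    filter_upwards [Metric.ball_mem_nhds a₂ hr] with x hx
    have hg : ∀ t ∈ Metric.ball a₂ r, HasDerivWithinAt (fun t => φ t - t) 0 (Metric.ball a₂ r) t :=
      fun t ht => by
        have := ((hb t ht).sub (hasDerivAt_id t)).hasDerivWithinAt (s := Metric.ball a₂ r)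
        rw [sub_self] at this
        exact this
    have := (convex_ball a₂ r).norm_image_sub_le_of_norm_hasDerivWithin_le (C := 0)
      hg (by simp) (Metric.mem_ball_self hr) hx
    rw [zero_mul, norm_le_zero_iff, hφa] at this
    linarith
  have hev : f₂ =ᶠ[nhds a₂] fun x => f₁ (x + (a₁ - a₂)) := by
    filter_upwards [h0, hφx] with x e1 e2
    rw [← e2]; exact (sub_eq_zero.mp e1).symm
  have han : AnalyticOnNhd ℝ (fun x => f₁ (x + (a₁ - a₂))) univ := fun x _ =>
    (h₁ _ (mem_univ _)).comp (analyticAt_id.add analyticAt_const)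
  exact fun x => congrFun (h₂.eq_of_eventuallyEq han hev) x

/-- The critical points of a non-constant analytic function in a compact interval are finite. -/
theorem finite_critical {f : ℝ → ℂ} (hf : AnalyticOnNhd ℝ f univ) (hnc : ¬ ∃ c, ∀ x, f x = c)
    (p : ℝ) : (Icc 0 p ∩ {x | deriv f x = 0}).Finite := by
  by_contra hinf
  obtain ⟨z, -, hz⟩ := Set.Infinite.exists_accPt_of_subset_isCompact hinf isCompact_Icc
    inter_subset_left
  rw [accPt_iff_frequently_nhdsNE] at hz
  have h0 := hf.deriv.eqOn_zero_of_preconnected_of_frequently_eq_zero isPreconnected_univ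
    (mem_univ z) (hz.mono fun x hx => hx.2)
  exact hnc ⟨f 0, fun x => is_const_of_deriv_eq_zero
    (fun t => (hf t (mem_univ t)).differentiableAt) (fun t => h0 (mem_univ t)) x 0⟩

/-! ### Vanishing of the form when there is no translation -/

section Main

variable {p₁ p₂ : ℝ} [Fact (0 < p₁)] [Fact (0 < p₂)]
  {μ : Measure (AddCircle p₂)} [IsFiniteMeasure μ] [NullSingletonClass μ]
  {ν : Measure (AddCircle p₁)} [IsFiniteMeasure ν] [NullSingletonClass ν]
  {B : C(AddCircle p₂, ℂ) →ₗ[ℂ] C(AddCircle p₁, ℂ) →ₗ[ℂ] ℂ} {M : ℝ}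
  {L₁ : C(AddCircle p₁, Metric.sphere (0 : ℂ) 1)} {L₂ : C(AddCircle p₂, Metric.sphere (0 : ℂ) 1)}
  {f₁ f₂ : ℝ → ℂ}

/-- A bounded form that intertwines two analytic functions, one of them non-constant and not
a translate of the other, and that depends continuously on simultaneous translations, is zero. -/
theorem form_eq_zero (hB : ∀ g f, ‖B g f‖ ≤ M * l2norm μ g * l2norm ν f) (hM : 0 ≤ M)
    (hI : ∀ g f, B g (toPlane L₁ * f) = B (toPlane L₂ * g) f)
    (hU : ∀ ε > 0, ∃ δ > 0, ∀ k : ℝ, |k| < δ → ∀ g f,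
      ‖B (shift k g) (shift k f) - B g f‖ ≤ ε * l2norm μ g * l2norm ν f)
    (hf₁ : ∀ x : ℝ, (L₁ x : ℂ) = f₁ x) (hf₂ : ∀ x : ℝ, (L₂ x : ℂ) = f₂ x)
    (h₁ : AnalyticOnNhd ℝ f₁ univ) (h₂ : AnalyticOnNhd ℝ f₂ univ)
    (hnc : ¬ ∃ c, ∀ x, f₁ x = c) (hnt : ¬ ∃ l, ∀ x, f₂ x = f₁ (x - l)) (g f) : B g f = 0 := by
  have good : ∀ a₂ a₁ : ℝ, ¬ (f₁ a₁ = f₂ a₂ ∧ deriv f₁ a₁ = deriv f₂ a₂) →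
      ∃ U ∈ nhds (a₂ : AddCircle p₂), ∃ V ∈ nhds (a₁ : AddCircle p₁), NullOn B U V := by
    intro a₂ a₁ h
    by_cases hv : f₁ a₁ = f₂ a₂
    · exact exists_nullOn_of_deriv_ne hB hM hI hU hf₁ hf₂
        (h₁ a₁ (mem_univ _)).hasStrictDerivAt (h₂ a₂ (mem_univ _)).hasStrictDerivAt
        fun hd => h ⟨hv, hd⟩
    · refine exists_nullOn_of_ne hB hM hI fun hL => hv ?_
      rw [← hf₁, ← hf₂, hL]
  have noncrit : ∀ a₂ a₁ : ℝ, deriv f₁ a₁ ≠ 0 →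
      ∃ U ∈ nhds (a₂ : AddCircle p₂), ∃ V ∈ nhds (a₁ : AddCircle p₁), NullOn B U V := by
    intro a₂ a₁ hne
    by_cases hbad : f₁ a₁ = f₂ a₂ ∧ deriv f₁ a₁ = deriv f₂ a₂
    swap
    · exact good a₂ a₁ hbad
    rcases translate_or_isolated h₁ h₂ hbad.1 hne with ht | ⟨r, hr, hiso⟩
    · exact absurd ⟨a₂ - a₁, fun x => by rw [ht x]; congr 1; ring⟩ hnt
    refine ⟨_, coe_image_ball_mem_nhds p₂ a₂ hr, _, coe_image_ball_mem_nhds p₁ a₁ hr, ?_⟩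
    intro g f hg hf
    -- Over the ball punctured at `a₂` every pair is good, and the point `a₂` has measure zero.
    refine form_eq_zero_of_locally_null hB
      (W := ((↑) : ℝ → AddCircle p₂) '' Metric.ball a₂ r \ {(a₂ : AddCircle p₂)})
      (W' := ((↑) : ℝ → AddCircle p₁) '' Metric.ball a₁ r)
      ((QuotientAddGroup.isOpenMap_coe _ Metric.isOpen_ball).sdiff isClosed_singleton)
      (QuotientAddGroup.isOpenMap_coe _ Metric.isOpen_ball) ?_ g f ?_
      (Filter.Eventually.of_forall hf)
    · rintro _ ⟨⟨s, hs, rfl⟩, hsa⟩ _ ⟨u, hu, rfl⟩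
      exact good s u (hiso s hs (fun h => hsa (by rw [h]; rfl)) u hu)
    · have hae : ∀ᵐ x ∂μ, x ≠ (a₂ : AddCircle p₂) := by
        rw [ae_iff]; simp
      filter_upwards [hae] with x hx hxW
      exact hg x fun h => hxW ⟨h, hx⟩
  have hopen : IsOpen {u : ℝ | deriv f₁ u ≠ 0} := by
    have : Continuous (deriv f₁) := continuousOn_univ.mp h₁.deriv.continuousOn
    exact isOpen_ne_fun this continuous_const
  -- The critical points of `f₁` come from finitely many in one period, so removing them changes
  -- nothing in `L²`.
  refine form_eq_zero_of_locally_null hB (W := univ)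
    (W' := ((↑) : ℝ → AddCircle p₁) '' {u | deriv f₁ u ≠ 0}) isOpen_univ
    (QuotientAddGroup.isOpenMap_coe _ hopen) ?_ g f (by simp) ?_
  · rintro x - _ ⟨u, hu, rfl⟩
    obtain ⟨s, rfl⟩ := QuotientAddGroup.mk_surjective x
    exact noncrit s u hu
  · have hfin : (((↑) : ℝ → AddCircle p₁) '' (Icc 0 p₁ ∩ {x | deriv f₁ x = 0})).Finite :=
      (finite_critical h₁ hnc p₁).image _
    have hae : ∀ᵐ y ∂ν, y ∉ ((↑) : ℝ → AddCircle p₁) '' (Icc 0 p₁ ∩ {x | deriv f₁ x = 0}) :=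
      measure_eq_zero_iff_ae_notMem.mp (hfin.measure_zero ν)
    filter_upwards [hae] with y hy hyW
    exfalso
    have hyI : y ∈ ((↑) : ℝ → AddCircle p₁) '' Icc 0 (0 + p₁) := by
      rw [AddCircle.coe_image_Icc_eq]; trivial
    obtain ⟨u, hu, rfl⟩ := hyI
    rw [zero_add] at hu
    by_cases hc : deriv f₁ u = 0
    · exact hy ⟨u, ⟨hu, hc⟩, rfl⟩
    · exact hyW ⟨u, hc, rfl⟩

end Main

/-! ### Diagonal spectral measures and their wave representation -/

section Diagonal

variable {H ι : Type*} [NormedAddCommGroup H] [InnerProductSpace ℂ H] [CompleteSpace H]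
  (b : HilbertBasis ι ℂ H) (x : ι → ℝ)

theorem dense_span_range : Dense (Submodule.span ℂ (range b) : Set H) := by
  rw [Submodule.dense_iff_topologicalClosure_eq_top]
  exact b.dense_span

theorem inner_diagonal_apply (T : H →L[ℂ] H) (c : ι → ℂ) (hT : ∀ i, T (b i) = c i • b i) (ξ : H)
    (i : ι) : ⟪b i, T ξ⟫_ℂ = c i * ⟪b i, ξ⟫_ℂ := by
  have h : (innerSL ℂ (b i)).comp T = c i • innerSL ℂ (b i) := by
    refine ContinuousLinearMap.ext_on (dense_span_range b) ?_
    rintro _ ⟨j, rfl⟩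
    simp only [ContinuousLinearMap.comp_apply, innerSL_apply_apply, hT, inner_smul_right,
      _root_.smul_apply, smul_eq_mul]
    by_cases hij : i = j
    · rw [hij]
    · rw [b.orthonormal.inner_eq_zero hij, mul_zero, mul_zero]
  exact congrArg (fun S : H →L[ℂ] ℂ => S ξ) h

theorem vecMeasure_diagonal (ξ : H) : (diagonalSpectralMeasure b x).vecMeasure ξ =
    Measure.sum fun i => ENNReal.ofReal (‖⟪b i, ξ⟫_ℂ‖ ^ 2) • Measure.dirac (x i) := by
  ext A hA
  rw [SpectralMeasure.vecMeasure_apply _ _ hA, Measure.sum_apply _ hA]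
  have h := b.hasSum_inner_mul_inner ξ ((diagonalSpectralMeasure b x).proj A ξ)
  have h2 := Complex.reCLM.hasSum h
  have hterm : ∀ i, Complex.reCLM (⟪ξ, b i⟫_ℂ * ⟪b i, (diagonalSpectralMeasure b x).proj A ξ⟫_ℂ)
      = {i | x i ∈ A}.indicator (fun i => ‖⟪b i, ξ⟫_ℂ‖ ^ 2) i := by
    intro i
    have e : ⟪b i, (diagonalSpectralMeasure b x).proj A ξ⟫_ℂ
      = {i | x i ∈ A}.indicator (fun i => ⟪b i, ξ⟫_ℂ) i := inner_starProjection b x A ξ i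
    rw [e]
    by_cases hi : i ∈ {i | x i ∈ A}
    · rw [indicator_of_mem hi, indicator_of_mem hi, ← inner_conj_symm, mul_comm, Complex.mul_conj,
        Complex.normSq_eq_norm_sq]
      rfl
    · rw [indicator_of_notMem hi, indicator_of_notMem hi]; simp
  simp only [hterm] at h2
  change ENNReal.ofReal (Complex.reCLM _) = _
  rw [← h2.tsum_eq, ENNReal.ofReal_tsum_of_nonneg _ h2.summable]
  · refine tsum_congr fun i => ?_
    rw [Measure.smul_apply, Measure.dirac_apply' _ hA]
    by_cases hi : x i ∈ A
    · rw [indicator_of_mem (show i ∈ {i | x i ∈ A} from hi), indicator_of_mem hi]; simp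
    · rw [indicator_of_notMem (show i ∉ {i | x i ∈ A} from hi), indicator_of_notMem hi]; simp
  · intro i
    exact indicator_nonneg (fun _ _ => sq_nonneg _) i

/-- The measure of `ξ` is a sum of point masses, so the integral of the exponential is the Parseval
sum for `⟪ξ, T ξ⟫`; the quadratic form determines the operator. -/
theorem eq_waveRep_diagonal (k : ℝ) (T : H →L[ℂ] H)
    (hT : ∀ i, T (b i) = Complex.exp (Complex.I * x i * k) • b i) :
    T = (diagonalSpectralMeasure b x).waveRep k := by
  refine SpectralMeasure.eq_waveRep _ k T fun ξ => ?_
  have hi : Integrable (fun s : ℝ => Complex.exp (Complex.I * s * k))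
      ((diagonalSpectralMeasure b x).vecMeasure ξ) := by
    refine Integrable.of_bound (Continuous.aestronglyMeasurable (by fun_prop)) 1
      (Filter.Eventually.of_forall fun s => ?_)
    have : Complex.I * s * k = ((s * k : ℝ) : ℂ) * Complex.I := by push_cast; ring
    rw [this, Complex.norm_exp_ofReal_mul_I]
  rw [vecMeasure_diagonal] at hi ⊢
  have hterm : (fun i => ∫ s : ℝ, Complex.exp (Complex.I * s * k)
      ∂(ENNReal.ofReal (‖⟪b i, ξ⟫_ℂ‖ ^ 2) • Measure.dirac (x i)))
      = fun i => ⟪ξ, b i⟫_ℂ * ⟪b i, T ξ⟫_ℂ := by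
    ext i
    rw [integral_smul_measure, integral_dirac, inner_diagonal_apply b T _ hT,
      ENNReal.toReal_ofReal (by positivity), Complex.real_smul, ← Complex.normSq_eq_norm_sq,
      ← Complex.mul_conj, inner_conj_symm]
    ring
  have hs := hasSum_integral_measure hi
  rw [hterm] at hs
  exact (b.hasSum_inner_mul_inner ξ (T ξ)).unique hs

end Diagonal

/-! ### Translations of the circle as the wave representation -/

section Torus

variable {p : ℝ} [Fact (0 < p)]

instance : NullSingletonClass (@AddCircle.haarAddCircle p _) := by
  constructor
  intro x
  have : (volume : Measure (AddCircle p)) {x} = 0 := by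
    rw [← Metric.closedBall_zero, AddCircle.volume_closedBall]
    have : (0 : ℝ) < p := Fact.out
    simp [this.le]
  rw [AddCircle.volume_eq_smul_haarAddCircle, Measure.smul_apply, smul_eq_mul, mul_eq_zero] at this
  refine this.resolve_left ?_
  simpa using (Fact.out : 0 < p)

/-- Translation by `k` on `L²(ℝ / pℤ)`. -/
noncomputable def translation (p : ℝ) [Fact (0 < p)] (k : ℝ) : TorusL2 p →ₗᵢ[ℂ] TorusL2 p :=
  Lp.compMeasurePreservingₗᵢ ℂ (fun x => x + (k : AddCircle p))
    (measurePreserving_add_right AddCircle.haarAddCircle _)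

theorem coeFn_translation (k : ℝ) (ξ : TorusL2 p) :
    translation p k ξ =ᵐ[AddCircle.haarAddCircle] fun x => ξ (x + (k : AddCircle p)) :=
  Lp.coeFn_compMeasurePreserving ξ (measurePreserving_add_right AddCircle.haarAddCircle _)

/-- The class of a continuous function in `L²(ℝ / pℤ)`. -/
noncomputable abbrev toL2 (f : C(AddCircle p, ℂ)) : TorusL2 p :=
  ContinuousMap.toLp (E := ℂ) 2 AddCircle.haarAddCircle ℂ f

theorem coeFn_toL2 (f : C(AddCircle p, ℂ)) : toL2 f =ᵐ[AddCircle.haarAddCircle] f :=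
  ContinuousMap.coeFn_toLp _ f

theorem translation_toL2 (k : ℝ) (f : C(AddCircle p, ℂ)) :
    translation p k (toL2 f) = toL2 (shift k f) := by
  apply Lp.ext
  have hq := (measurePreserving_add_right (@AddCircle.haarAddCircle p _)
    (k : AddCircle p)).quasiMeasurePreserving
  filter_upwards [coeFn_translation k (toL2 f), coeFn_toL2 (shift k f),
    hq.ae (coeFn_toL2 f)] with x h1 h2 h3
  rw [h1, h2, h3, shift_apply]

theorem shift_fourier (k : ℝ) (n : ℤ) : shift k (fourier n : C(AddCircle p, ℂ)) =
    Complex.exp (Complex.I * (2 * Real.pi * n / p : ℝ) * k) • (fourier n : C(AddCircle p, ℂ)) := by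
  ext x
  obtain ⟨s, rfl⟩ := QuotientAddGroup.mk_surjective x
  rw [shift_apply, ContinuousMap.smul_apply]
  change fourier n ((s : AddCircle p) + (k : AddCircle p)) = _ • fourier n (s : AddCircle p)
  rw [← AddCircle.coe_add, fourier_coe_apply, fourier_coe_apply, smul_eq_mul, ← Complex.exp_add]
  congr 1
  push_cast
  ring

theorem fourierBasis_eq_toL2 (n : ℤ) : fourierBasis (T := p) n = toL2 (fourier n) := by
  rw [coe_fourierBasis]

theorem translation_fourierBasis (k : ℝ) (n : ℤ) : translation p k (fourierBasis n) =
    Complex.exp (Complex.I * (2 * Real.pi * n / p : ℝ) * k) • fourierBasis n := by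
  rw [fourierBasis_eq_toL2, translation_toL2, shift_fourier]
  exact (ContinuousMap.toLp (E := ℂ) 2 AddCircle.haarAddCircle ℂ).map_smul _ _

/-- The characters are eigenvectors of translation with exactly the eigenvalues prescribed by the
coordinate. Regularity of an operator thereby becomes a statement about translations. -/
theorem waveRep_torusCoord (k : ℝ) :
    (torusCoord p).waveRep k = (translation p k).toContinuousLinearMap :=
  (eq_waveRep_diagonal _ _ k _ (translation_fourierBasis k)).symm

theorem dense_range_toL2 : DenseRange (toL2 (p := p)) :=
  ContinuousMap.toLp_denseRange ℂ _ ℂ (by norm_num)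

end Torus

/-! ### A Bernstein inequality -/

/-- The Fourier expansion of the triangular wave. -/
theorem hasSum_triangular {R s : ℝ} (hR : 0 < R) (hs : |s| ≤ R) :
    HasSum (fun n : ℕ => -(4 * R / Real.pi ^ 2) * (1 / (n : ℝ) ^ 2 *
      (Real.cos (Real.pi * n / (2 * R) * s + Real.pi * n / 2)
        - Real.cos (Real.pi * n / (2 * R) * s + Real.pi * n * 3 / 2)))) s := by
  obtain ⟨hs1, hs2⟩ := abs_le.mp hs
  have hx0 : 0 ≤ s / (4 * R) + 1 / 4 := by
    have : -(1 / 4) ≤ s / (4 * R) := by rw [le_div_iff₀ (by positivity)]; linarith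
    linarith
  have hx1 : s / (4 * R) + 1 / 4 ≤ 1 / 2 := by
    have : s / (4 * R) ≤ 1 / 4 := by rw [div_le_iff₀ (by positivity)]; linarith
    linarith
  -- The second Bernoulli polynomial satisfies `B₂(x) - B₂(x + 1/2) = 1/4 - x`, which is linear.
  -- With `x = s / (4R) + 1/4`, the condition `|s| ≤ R` keeps both points in `[0, 1]`, where the
  -- cosine series is valid.
  have h1 := hasSum_one_div_nat_pow_mul_cos one_ne_zero
    (x := s / (4 * R) + 1 / 4) ⟨hx0, by linarith⟩
  have h2 := hasSum_one_div_nat_pow_mul_cos one_ne_zero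
    (x := s / (4 * R) + 1 / 4 + 1 / 2) ⟨by linarith, by linarith⟩
  have hb : ∀ x : ℝ, Polynomial.eval x (Polynomial.map (algebraMap ℚ ℝ)
      (Polynomial.bernoulli (2 * 1))) = x ^ 2 - x + 6⁻¹ := bernoulliFun_two
  rw [hb] at h1 h2
  have h3 := (h1.sub h2).mul_left (-(4 * R / Real.pi ^ 2))
  have hpi := Real.pi_ne_zero
  have hval : -(4 * R / Real.pi ^ 2) *
      ((-1) ^ (1 + 1) * (2 * Real.pi) ^ (2 * 1) / 2 / ((2 * 1).factorial : ℝ) *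
          ((s / (4 * R) + 1 / 4) ^ 2 - (s / (4 * R) + 1 / 4) + 6⁻¹) -
        (-1) ^ (1 + 1) * (2 * Real.pi) ^ (2 * 1) / 2 / ((2 * 1).factorial : ℝ) *
          ((s / (4 * R) + 1 / 4 + 1 / 2) ^ 2 - (s / (4 * R) + 1 / 4 + 1 / 2) + 6⁻¹)) = s := by
    norm_num [Nat.factorial]
    field_simp
    ring
  rw [hval] at h3
  refine h3.congr_fun fun n => ?_
  have e1 : Real.pi * n / (2 * R) * s + Real.pi * n / 2
      = 2 * Real.pi * n * (s / (4 * R) + 1 / 4) := by field_simp; ring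
  have e2 : Real.pi * n / (2 * R) * s + Real.pi * n * 3 / 2
      = 2 * Real.pi * n * (s / (4 * R) + 1 / 4 + 1 / 2) := by field_simp; ring
  rw [e1, e2, mul_one, ← mul_sub]

/-- A Bernstein inequality for trigonometric sums with frequencies in `[-R, R]`. -/
theorem bernstein {R : ℝ} (hR : 0 < R) : ∃ C : ℝ, 0 ≤ C ∧ ∀ {ι : Type} (t : Finset ι) (c : ι → ℂ)
    (s : ι → ℝ) (M : ℝ), (∀ i ∈ t, c i ≠ 0 → |s i| ≤ R) →
    (∀ k : ℝ, ‖∑ i ∈ t, c i * Complex.exp (Complex.I * s i * k)‖ ≤ M) →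
    ∀ k : ℝ, ‖∑ i ∈ t, c i * Complex.exp (Complex.I * s i * k) - ∑ i ∈ t, c i‖ ≤ C * M * |k| := by
  have hsum : Summable fun n : ℕ => 4 * R / Real.pi ^ 2 * (1 / (n : ℝ) ^ 2 * 2) :=
    ((Real.summable_one_div_nat_pow.mpr one_lt_two).mul_right 2).mul_left _
  refine ⟨∑' n : ℕ, 4 * R / Real.pi ^ 2 * (1 / (n : ℝ) ^ 2 * 2),
    tsum_nonneg fun n => by positivity, fun {ι} t c s M hs hM k => ?_⟩
  -- Multiplying the coefficients by a cosine of the frequency averages two translates of the sum,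
  -- up to unimodular factors, so the bound `M` survives.
  have hcos : ∀ k τ α : ℝ,
      ‖∑ i ∈ t, c i * Complex.exp (Complex.I * s i * k) * Real.cos (τ * s i + α)‖ ≤ M := by
    intro k τ α
    have e : ∑ i ∈ t, c i * Complex.exp (Complex.I * s i * k) * Real.cos (τ * s i + α)
        = (1 / 2) * (Complex.exp (α * Complex.I)
            * ∑ i ∈ t, c i * Complex.exp (Complex.I * s i * (k + τ : ℝ)))
          + (1 / 2) * (Complex.exp ((-α : ℝ) * Complex.I)
            * ∑ i ∈ t, c i * Complex.exp (Complex.I * s i * (k - τ : ℝ))) := by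
      simp only [Finset.mul_sum]
      rw [← Finset.sum_add_distrib]
      refine Finset.sum_congr rfl fun i _ => ?_
      rw [Complex.ofReal_cos, Complex.cos]
      have e1 : Complex.exp (((τ * s i + α : ℝ) : ℂ) * Complex.I) * Complex.exp (Complex.I * s i * k)
          = Complex.exp (α * Complex.I) * Complex.exp (Complex.I * s i * (k + τ : ℝ)) := by
        rw [← Complex.exp_add, ← Complex.exp_add]; congr 1; push_cast; ring
      have e2 : Complex.exp (-((τ * s i + α : ℝ) : ℂ) * Complex.I)
            * Complex.exp (Complex.I * s i * k)
          = Complex.exp ((-α : ℝ) * Complex.I)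
            * Complex.exp (Complex.I * s i * (k - τ : ℝ)) := by
        rw [← Complex.exp_add, ← Complex.exp_add]; congr 1; push_cast; ring
      linear_combination (c i / 2) * e1 + (c i / 2) * e2
    rw [e]
    have b1 := hM (k + τ)
    have b2 := hM (k - τ)
    refine (norm_add_le _ _).trans ?_
    rw [norm_mul, norm_mul, norm_mul (1 / 2 : ℂ), norm_mul, Complex.norm_exp_ofReal_mul_I,
      Complex.norm_exp_ofReal_mul_I, show ‖(1 / 2 : ℂ)‖ = 1 / 2 by norm_num]
    linarith
  let F : ℝ → ℂ := fun k => ∑ i ∈ t, c i * Complex.exp (Complex.I * s i * k)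
  let F' : ℝ → ℂ := fun k => ∑ i ∈ t, c i * (Complex.exp (Complex.I * s i * k) * (Complex.I * s i))
  have hF : ∀ k, HasDerivAt F (F' k) k := by
    intro k
    refine HasDerivAt.fun_sum fun i _ => HasDerivAt.const_mul _ ?_
    have h1 : HasDerivAt (fun k : ℝ => Complex.I * s i * (k : ℂ)) (Complex.I * s i) k := by
      simpa using (Complex.ofRealCLM.hasDerivAt (x := k)).const_mul (Complex.I * s i)
    exact h1.cexp
  -- Differentiation multiplies each coefficient by `i s`; expanding `s` into the absolutely
  -- convergent triangular series reduces this to `hcos`.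
  have hF' : ∀ k, ‖F' k‖ ≤ (∑' n : ℕ, 4 * R / Real.pi ^ 2 * (1 / (n : ℝ) ^ 2 * 2)) * M := by
    intro k
    have hs1 : HasSum (fun n : ℕ => ∑ i ∈ t,
        c i * Complex.exp (Complex.I * s i * k) * Complex.I * ((-(4 * R / Real.pi ^ 2)
        * (1 / (n : ℝ) ^ 2 * (Real.cos (Real.pi * n / (2 * R) * s i + Real.pi * n / 2)
        - Real.cos (Real.pi * n / (2 * R) * s i + Real.pi * n * 3 / 2))) : ℝ) : ℂ))
        (∑ i ∈ t, c i * Complex.exp (Complex.I * s i * k) * Complex.I * s i) := by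
      refine hasSum_sum fun i hi => ?_
      by_cases hc : c i = 0
      · simp [hc, hasSum_zero]
      · exact (Complex.hasSum_ofReal.mpr (hasSum_triangular hR (hs i hi hc))).mul_left _
    have e : F' k = ∑ i ∈ t, c i * Complex.exp (Complex.I * s i * k) * Complex.I * s i :=
      Finset.sum_congr rfl fun i _ => by ring
    rw [e]
    refine hs1.norm_le_of_bounded (hsum.hasSum.mul_right M) fun n => ?_
    have e2 : ∑ i ∈ t, c i * Complex.exp (Complex.I * s i * k) * Complex.I
        * ((-(4 * R / Real.pi ^ 2)
        * (1 / (n : ℝ) ^ 2 * (Real.cos (Real.pi * n / (2 * R) * s i + Real.pi * n / 2)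
        - Real.cos (Real.pi * n / (2 * R) * s i + Real.pi * n * 3 / 2))) : ℝ) : ℂ)
        = -(Complex.I * ((4 * R / Real.pi ^ 2 * (1 / (n : ℝ) ^ 2) : ℝ) : ℂ)) *
          (∑ i ∈ t, c i * Complex.exp (Complex.I * s i * k) *
            Real.cos (Real.pi * n / (2 * R) * s i + Real.pi * n / 2)
          - ∑ i ∈ t, c i * Complex.exp (Complex.I * s i * k) *
            Real.cos (Real.pi * n / (2 * R) * s i + Real.pi * n * 3 / 2)) := by
      rw [← Finset.sum_sub_distrib, Finset.mul_sum]
      refine Finset.sum_congr rfl fun i _ => ?_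
      push_cast
      ring
    rw [e2, norm_mul, norm_neg, norm_mul, Complex.norm_I, one_mul, Complex.norm_real,
      Real.norm_of_nonneg (by positivity)]
    have b1 := hcos k (Real.pi * n / (2 * R)) (Real.pi * n / 2)
    have b2 := hcos k (Real.pi * n / (2 * R)) (Real.pi * n * 3 / 2)
    calc _ ≤ 4 * R / Real.pi ^ 2 * (1 / (n : ℝ) ^ 2) * (M + M) :=
          mul_le_mul_of_nonneg_left ((norm_sub_le _ _).trans (add_le_add b1 b2)) (by positivity)
      _ = _ := by ring
  have := (convex_univ (𝕜 := ℝ)).norm_image_sub_le_of_norm_hasDerivWithin_le (f := F) (f' := F')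
    (fun x _ => (hF x).hasDerivWithinAt) (fun x _ => hF' x) (mem_univ 0) (mem_univ k)
  simpa [F] using this

/-! ### Finite propagation implies continuity under translation -/

section FinitePropagation

variable {H₁ H₂ : Type*} [NormedAddCommGroup H₁] [InnerProductSpace ℂ H₁] [CompleteSpace H₁]
  [NormedAddCommGroup H₂] [InnerProductSpace ℂ H₂] [CompleteSpace H₂] {ι : Type}
  {b₁ : HilbertBasis ι ℂ H₁} {x₁ : ι → ℝ} {b₂ : HilbertBasis ι ℂ H₂} {x₂ : ι → ℝ}

theorem diagonal_proj_singleton {H : Type*} [NormedAddCommGroup H] [InnerProductSpace ℂ H]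
    [CompleteSpace H] (b : HilbertBasis ι ℂ H) (x : ι → ℝ) (i : ι) :
    (diagonalSpectralMeasure b x).proj {x i} (b i) = b i :=
  Submodule.starProjection_eq_self_iff.mpr
    (Submodule.le_topologicalClosure _ (Submodule.subset_span ⟨i, rfl, rfl⟩))

/-- Finite propagation tested on the singletons of two positions: the matrix of `T` is supported in
a band. -/
theorem inner_eq_zero_of_propagation {T : H₁ →L[ℂ] H₂} {R : ℝ≥0}
    (hT : ∀ A₁ A₂ : Set ℝ, MeasurableSet A₁ → MeasurableSet A₂ → (R : ℝ≥0∞) < setDist A₁ A₂ →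
      (diagonalSpectralMeasure b₂ x₂).proj A₂ ∘L T ∘L (diagonalSpectralMeasure b₁ x₁).proj A₁ = 0)
    {i j : ι} (hij : R < |x₁ i - x₂ j|) : ⟪b₂ j, T (b₁ i)⟫_ℂ = 0 := by
  have h := hT {x₁ i} {x₂ j} (measurableSet_singleton _) (measurableSet_singleton _) (by
    rw [setDist]
    simp only [mem_singleton_iff, iInf_iInf_eq_left]
    rw [edist_dist, Real.dist_eq]
    exact (ENNReal.lt_ofReal_iff_toReal_lt ENNReal.coe_ne_top).mpr (by simpa using hij))
  have h1 := congrArg (fun S : H₁ →L[ℂ] H₂ => ⟪b₂ j, S (b₁ i)⟫_ℂ) h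
  simp only [ContinuousLinearMap.comp_apply, diagonal_proj_singleton] at h1
  have h2 : ⟪b₂ j, (diagonalSpectralMeasure b₂ x₂).proj {x₂ j} (T (b₁ i))⟫_ℂ = ⟪b₂ j, T (b₁ i)⟫_ℂ := by
    refine (inner_starProjection b₂ x₂ {x₂ j} (T (b₁ i)) j).trans ?_
    exact indicator_of_mem (s := {i | x₂ i ∈ ({x₂ j} : Set ℝ)}) rfl _
  rw [h2] at h1
  simpa using h1

/-- An operator of finite propagation depends continuously on simultaneous translations. -/
theorem exists_translation_bound {T : H₁ →L[ℂ] H₂}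
    (hT : HasFinitePropagation (diagonalSpectralMeasure b₁ x₁) (diagonalSpectralMeasure b₂ x₂) T)
    {τ₁ : ℝ → H₁ →ₗᵢ[ℂ] H₁} {τ₂ : ℝ → H₂ →ₗᵢ[ℂ] H₂}
    (h₁ : ∀ k i, τ₁ k (b₁ i) = Complex.exp (Complex.I * x₁ i * k) • b₁ i)
    (h₂ : ∀ k i, τ₂ k (b₂ i) = Complex.exp (Complex.I * x₂ i * k) • b₂ i) :
    ∃ C : ℝ, 0 ≤ C ∧ ∀ (k : ℝ) (η : H₂) (ξ : H₁),
      ‖⟪τ₂ k η, T (τ₁ k ξ)⟫_ℂ - ⟪η, T ξ⟫_ℂ‖ ≤ C * |k| * ‖η‖ * ‖ξ‖ := by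
  obtain ⟨R, hR⟩ := hT
  -- `R` may be zero, whereas `bernstein` needs a positive bandwidth.
  obtain ⟨C, hC, hb⟩ := bernstein (R := R + 1) (by positivity)
  refine ⟨C * ‖T‖, by positivity, fun k => ?_⟩
  have hspan : ∀ η ∈ Submodule.span ℂ (range b₂), ∀ ξ ∈ Submodule.span ℂ (range b₁),
      ‖⟪τ₂ k η, T (τ₁ k ξ)⟫_ℂ - ⟪η, T ξ⟫_ℂ‖ ≤ C * ‖T‖ * |k| * ‖η‖ * ‖ξ‖ := by
    intro η hη ξ hξ
    obtain ⟨d, rfl⟩ := (Finsupp.mem_span_range_iff_exists_finsupp).mp hη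
    obtain ⟨c, rfl⟩ := (Finsupp.mem_span_range_iff_exists_finsupp).mp hξ
    set η := d.sum fun i a => a • b₂ i with hηd
    set ξ := c.sum fun i a => a • b₁ i with hξd
    let z : ι × ι → ℂ := fun q => (starRingEnd ℂ) (d q.1) * c q.2 * ⟪b₂ q.1, T (b₁ q.2)⟫_ℂ
    -- The frequencies are differences of positions, so by the band property only those of size at
    -- most `R` carry a non-zero coefficient.
    have hexp : ∀ k : ℝ, ⟪τ₂ k η, T (τ₁ k ξ)⟫_ℂ = ∑ q ∈ d.support ×ˢ c.support,
        z q * Complex.exp (Complex.I * (x₁ q.2 - x₂ q.1 : ℝ) * k) := by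
      intro k
      have hη1 : τ₂ k η = ∑ j ∈ d.support, d j • Complex.exp (Complex.I * x₂ j * k) • b₂ j := by
        rw [hηd, Finsupp.sum, map_sum]
        exact Finset.sum_congr rfl fun j _ => by rw [map_smul, h₂]
      have hξ1 : T (τ₁ k ξ) =
          ∑ i ∈ c.support, c i • Complex.exp (Complex.I * x₁ i * k) • T (b₁ i) := by
        rw [hξd, Finsupp.sum, map_sum, map_sum]
        exact Finset.sum_congr rfl fun j _ => by rw [map_smul, h₁, map_smul, map_smul]
      rw [hη1, hξ1, sum_inner, Finset.sum_product]
      refine Finset.sum_congr rfl fun j _ => ?_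
      rw [inner_sum]
      refine Finset.sum_congr rfl fun i _ => ?_
      rw [inner_smul_left, inner_smul_left, inner_smul_right, inner_smul_right, ← Complex.exp_conj]
      have e : Complex.exp (Complex.I * (x₁ i - x₂ j : ℝ) * k)
          = Complex.exp ((starRingEnd ℂ) (Complex.I * x₂ j * k))
            * Complex.exp (Complex.I * x₁ i * k) := by
        rw [← Complex.exp_add]
        congr 1
        simp only [map_mul, Complex.conj_I, Complex.conj_ofReal]
        push_cast
        ring
      simp only [z, e]
      ring
    have h0 : ⟪η, T ξ⟫_ℂ = ∑ q ∈ d.support ×ˢ c.support, z q := by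
      have hη1 : η = ∑ j ∈ d.support, d j • b₂ j := rfl
      have hξ1 : T ξ = ∑ i ∈ c.support, c i • T (b₁ i) := by
        rw [hξd, Finsupp.sum, map_sum]
        exact Finset.sum_congr rfl fun j _ => by rw [map_smul]
      rw [hη1, hξ1, sum_inner, Finset.sum_product]
      refine Finset.sum_congr rfl fun j _ => ?_
      rw [inner_sum]
      refine Finset.sum_congr rfl fun i _ => ?_
      rw [inner_smul_left, inner_smul_right]
      simp only [z]
      ring
    rw [hexp, h0]
    refine (hb _ z (fun q => x₁ q.2 - x₂ q.1) (‖T‖ * ‖η‖ * ‖ξ‖) ?_ ?_ k).trans_eq (by ring)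
    · intro q _ hq
      by_contra hcon
      push Not at hcon
      refine hq ?_
      simp only [z]
      rw [inner_eq_zero_of_propagation hR (by linarith), mul_zero]
    · intro k
      rw [← hexp]
      calc ‖⟪τ₂ k η, T (τ₁ k ξ)⟫_ℂ‖ ≤ ‖τ₂ k η‖ * ‖T (τ₁ k ξ)‖ := norm_inner_le_norm _ _
        _ ≤ ‖τ₂ k η‖ * (‖T‖ * ‖τ₁ k ξ‖) := by gcongr; exact T.le_opNorm _
        _ = ‖T‖ * ‖η‖ * ‖ξ‖ := by rw [LinearIsometry.norm_map, LinearIsometry.norm_map]; ring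
  intro η ξ
  have hτ₁ := (τ₁ k).continuous
  have hτ₂ := (τ₂ k).continuous
  have hd : Dense ((Submodule.span ℂ (range b₂) : Set H₂) ×ˢ
      (Submodule.span ℂ (range b₁) : Set H₁)) :=
    (dense_span_range b₂).prod (dense_span_range b₁)
  have hcl : IsClosed {q : H₂ × H₁ | ‖⟪τ₂ k q.1, T (τ₁ k q.2)⟫_ℂ - ⟪q.1, T q.2⟫_ℂ‖
      ≤ C * ‖T‖ * |k| * ‖q.1‖ * ‖q.2‖} :=
    isClosed_le (by fun_prop) (by fun_prop)
  exact hcl.closure_subset_iff.mpr (fun q hq => hspan q.1 hq.1 q.2 hq.2) (hd (η, ξ))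

end FinitePropagation

/-- Sets at positive distance are disjoint and a diagonal operator moves no basis vector to another
position, so `R = 0` works. -/
theorem hasFinitePropagation_of_diagonal {H ι : Type*} [NormedAddCommGroup H]
    [InnerProductSpace ℂ H] [CompleteSpace H] (b : HilbertBasis ι ℂ H) (x : ι → ℝ)
    (T : H →L[ℂ] H) (c : ι → ℂ) (hT : ∀ i, T (b i) = c i • b i) :
    HasFinitePropagation (diagonalSpectralMeasure b x) (diagonalSpectralMeasure b x) T := by
  refine ⟨0, fun A₁ A₂ _ _ hd => ?_⟩
  have hdis : ∀ a, a ∈ A₂ → a ∉ A₁ := by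
    intro a h2 h1
    have : setDist A₁ A₂ ≤ edist a a :=
      (iInf₂_le a h1).trans (iInf₂_le a h2)
    rw [edist_self] at this
    exact absurd hd (by simpa using this)
  have hproj : ∀ (A : Set ℝ) (ζ : H) (i : ι), ⟪b i, (diagonalSpectralMeasure b x).proj A ζ⟫_ℂ
      = {i | x i ∈ A}.indicator (fun i => ⟪b i, ζ⟫_ℂ) i := fun A ζ i => inner_starProjection b x A ζ i
  ext1 ξ
  apply b.repr.injective
  ext i
  rw [HilbertBasis.repr_apply_apply, HilbertBasis.repr_apply_apply, ContinuousLinearMap.comp_apply,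
    hproj, _root_.zero_apply, inner_zero_right]
  by_cases hi : i ∈ {i | x i ∈ A₂}
  · rw [indicator_of_mem hi, ContinuousLinearMap.comp_apply, inner_diagonal_apply b T c hT, hproj,
      indicator_of_notMem (s := {i | x i ∈ A₁}) (hdis _ hi), mul_zero]
  · exact indicator_of_notMem hi _

/-! ### Translations as regular operators -/

section Translation

variable {p : ℝ} [Fact (0 < p)]

theorem translation_translation (k l : ℝ) (ξ : TorusL2 p) :
    translation p k (translation p l ξ) = translation p (k + l) ξ := by
  have h : ∀ f : C(AddCircle p, ℂ), shift k (shift l f) = shift (k + l) f := fun f => by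
    ext x
    simp only [shift_apply, AddCircle.coe_add, add_assoc]
  refine dense_range_toL2.induction_on ξ ?_ fun f => ?_
  · exact isClosed_eq ((translation p k).continuous.comp (translation p l).continuous)
      (translation p (k + l)).continuous
  · rw [translation_toL2, translation_toL2, translation_toL2, h]

theorem translation_zero (ξ : TorusL2 p) : translation p 0 ξ = ξ := by
  refine dense_range_toL2.induction_on ξ ?_ fun f => ?_
  · exact isClosed_eq (translation p 0).continuous continuous_id
  · rw [translation_toL2]
    congr 1
    ext x
    simp [shift_apply]

/-- Translation by `k` as a unitary operator. -/
noncomputable def translationEquiv (p : ℝ) [Fact (0 < p)] (k : ℝ) : TorusL2 p ≃ₗᵢ[ℂ] TorusL2 p :=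
  LinearIsometryEquiv.ofSurjective (translation p k) fun ξ =>
    ⟨translation p (-k) ξ, by rw [translation_translation, add_neg_cancel, translation_zero]⟩

theorem mulOp_apply (F : C(AddCircle p, Circle)) (ξ : TorusL2 p) :
    mulOp F ξ = mulIsometry F ξ := rfl

theorem translation_mulOp {F G : C(AddCircle p, Circle)} {k : ℝ}
    (h : ∀ x, G x = F (x + (k : AddCircle p))) (ξ : TorusL2 p) :
    translation p k (mulOp F ξ) = mulOp G (translation p k ξ) := by
  rw [mulOp_apply, mulOp_apply]
  apply Lp.ext
  have hq := (measurePreserving_add_right (@AddCircle.haarAddCircle p _)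
    (k : AddCircle p)).quasiMeasurePreserving
  filter_upwards [coeFn_translation k (mulIsometry F ξ), coeFn_mulIsometry G (translation p k ξ),
    coeFn_translation k ξ, hq.ae (coeFn_mulIsometry F ξ)] with x h1 h2 h3 h4
  rw [h1, h2, h3, h4, h]

/-- The wave operators are translations too, and translations commute. -/
theorem conjugate_translation (l k : ℝ) :
    conjugate (torusCoord p) (torusCoord p) (translation p l).toContinuousLinearMap k
      = (translation p l).toContinuousLinearMap := by
  ext1 ξ
  simp only [conjugate, waveRep_torusCoord, ContinuousLinearMap.comp_apply,
    LinearIsometry.coe_toContinuousLinearMap, translation_translation]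
  congr 2
  ring

theorem isSmooth_translation (l : ℝ) :
    IsSmooth (torusCoord p) (torusCoord p) (translation p l).toContinuousLinearMap := by
  have h : conjugate (torusCoord p) (torusCoord p) (translation p l).toContinuousLinearMap
      = fun _ => (translation p l).toContinuousLinearMap := funext (conjugate_translation l)
  rw [IsSmooth, h]
  exact contDiff_const

theorem hasFinitePropagation_translation (l : ℝ) :
    HasFinitePropagation (torusCoord p) (torusCoord p) (translation p l).toContinuousLinearMap :=
  hasFinitePropagation_of_diagonal _ _ _ _ (translation_fourierBasis l)

end Translation

/-! ### From intertwiners to forms -/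

section Intertwiner

variable {p₁ p₂ : ℝ} [Fact (0 < p₁)] [Fact (0 < p₂)]

theorem toL2_add {p : ℝ} [Fact (0 < p)] (f g : C(AddCircle p, ℂ)) :
    toL2 (f + g) = toL2 f + toL2 g :=
  map_add (ContinuousMap.toLp (E := ℂ) 2 AddCircle.haarAddCircle ℂ) f g

theorem toL2_smul {p : ℝ} [Fact (0 < p)] (c : ℂ) (f : C(AddCircle p, ℂ)) :
    toL2 (c • f) = c • toL2 f :=
  map_smul (ContinuousMap.toLp (E := ℂ) 2 AddCircle.haarAddCircle ℂ) c f

/-- The form `(g, f) ↦ ∫ g · T f` on continuous functions. -/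
noncomputable def formOf (T : TorusL2 p₁ →L[ℂ] TorusL2 p₂) :
    C(AddCircle p₂, ℂ) →ₗ[ℂ] C(AddCircle p₁, ℂ) →ₗ[ℂ] ℂ :=
  -- The `star` cancels the conjugation in the inner product, so the form is bilinear and the same
  -- `h` appears on both sides of the intertwining relation.
  LinearMap.mk₂ ℂ (fun g f => ⟪toL2 (star g), T (toL2 f)⟫_ℂ)
    (fun g g' f => by rw [star_add, toL2_add, inner_add_left])
    (fun c g f => by rw [star_smul, toL2_smul, inner_smul_left]; simp)
    (fun g f f' => by rw [toL2_add, map_add, inner_add_right])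
    (fun c g f => by rw [toL2_smul, map_smul, inner_smul_right]; rfl)

theorem formOf_apply (T : TorusL2 p₁ →L[ℂ] TorusL2 p₂) (g f) :
    formOf T g f = ⟪toL2 (star g), T (toL2 f)⟫_ℂ := rfl

theorem norm_toL2 {p : ℝ} [Fact (0 < p)] (f : C(AddCircle p, ℂ)) :
    ‖toL2 f‖ = l2norm AddCircle.haarAddCircle f := rfl

theorem norm_toL2_star {p : ℝ} [Fact (0 < p)] (f : C(AddCircle p, ℂ)) :
    ‖toL2 (star f)‖ = l2norm AddCircle.haarAddCircle f :=
  le_antisymm (l2norm_le _ _ _ fun x => by simp) (l2norm_le _ _ _ fun x => by simp)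

theorem norm_formOf_le (T : TorusL2 p₁ →L[ℂ] TorusL2 p₂) (g f) : ‖formOf T g f‖
    ≤ ‖T‖ * l2norm AddCircle.haarAddCircle g * l2norm AddCircle.haarAddCircle f := by
  rw [formOf_apply, ← norm_toL2_star g, ← norm_toL2 f]
  calc _ ≤ ‖toL2 (star g)‖ * ‖T (toL2 f)‖ := norm_inner_le_norm _ _
    _ ≤ ‖toL2 (star g)‖ * (‖T‖ * ‖toL2 f‖) := by gcongr; exact T.le_opNorm _
    _ = _ := by ring

theorem eq_zero_of_formOf {T : TorusL2 p₁ →L[ℂ] TorusL2 p₂} (h : ∀ g f, formOf T g f = 0) :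
    T = 0 := by
  have h1 : ∀ f, T (toL2 f) = 0 := by
    intro f
    have h2 : ∀ η : TorusL2 p₂, ⟪η, T (toL2 f)⟫_ℂ = 0 := by
      intro η
      refine dense_range_toL2.induction_on η (isClosed_eq (by fun_prop) continuous_const) fun g => ?_
      have := h (star g) f
      rwa [formOf_apply, star_star] at this
    exact inner_self_eq_zero.mp (h2 _)
  ext1 ξ
  refine dense_range_toL2.induction_on ξ ?_ h1
  exact isClosed_eq T.continuous continuous_const

/-- A circle-valued function as a function with values in the unit sphere of `ℂ`. -/
noncomputable def toSphere {X : Type*} [TopologicalSpace X] (F : C(X, Circle)) : C(X, Metric.sphere (0 : ℂ) 1) :=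
  ⟨fun x => ⟨(F x : ℂ), (F x).2⟩, by fun_prop⟩

theorem mulOp_toL2 {p : ℝ} [Fact (0 < p)] (F : C(AddCircle p, Circle)) (f : C(AddCircle p, ℂ)) :
    mulOp F (toL2 f) = toL2 (toPlane (toSphere F) * f) := by
  rw [mulOp_apply]
  apply Lp.ext
  filter_upwards [coeFn_mulIsometry F (toL2 f), coeFn_toL2 f,
    coeFn_toL2 (toPlane (toSphere F) * f)] with x h1 h2 h3
  rw [h1, h2, h3]
  rfl

/-- Multiplication by `F₂` is unitary, so it can be moved to the other side of the inner product as
multiplication by the conjugate. -/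
theorem formOf_intertwines {T : TorusL2 p₁ →L[ℂ] TorusL2 p₂} {F₁ : C(AddCircle p₁, Circle)}
    {F₂ : C(AddCircle p₂, Circle)} (hT : ∀ ξ, T (mulOp F₁ ξ) = mulOp F₂ (T ξ)) (g f) :
    formOf T g (toPlane (toSphere F₁) * f) = formOf T (toPlane (toSphere F₂) * g) f := by
  rw [formOf_apply, formOf_apply, ← mulOp_toL2, hT]
  have h : toL2 (star g) = mulOp F₂ (toL2 (star (toPlane (toSphere F₂) * g))) := by
    rw [mulOp_toL2, star_mul', ← mul_assoc, mul_comm (toPlane _) (star _), star_toPlane_mul,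
      one_mul]
  rw [h, LinearIsometryEquiv.inner_map_map]

/-- A non-zero intertwiner of model walks that depends continuously on simultaneous translations
exists only between translates. -/
theorem exists_translate {lam₁ lam₂ : ℝ → Circle} (han₁ : IsAnalytic lam₁) (han₂ : IsAnalytic lam₂)
    (hnc₁ : ¬ ∃ c, ∀ k, lam₁ k = c) (hp₁ : Function.Periodic lam₁ p₁)
    (hp₂ : Function.Periodic lam₂ p₂) {T : TorusL2 p₁ →L[ℂ] TorusL2 p₂} (hT0 : T ≠ 0)
    (hT : (modelWalk han₁.continuous hp₁).IsIntertwiner (modelWalk han₂.continuous hp₂) T)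
    (hU : ∀ ε > 0, ∃ δ > 0, ∀ k : ℝ, |k| < δ → ∀ η ξ,
      ‖⟪translation p₂ k η, T (translation p₁ k ξ)⟫_ℂ - ⟪η, T ξ⟫_ℂ‖ ≤ ε * ‖η‖ * ‖ξ‖) :
    ∃ l : ℝ, ∀ k, lam₂ k = lam₁ (k - l) := by
  by_contra hnt
  refine hT0 (eq_zero_of_formOf fun g f => ?_)
  refine form_eq_zero (norm_formOf_le T) (norm_nonneg T) (formOf_intertwines hT)
    (f₁ := fun k => (lam₁ k : ℂ)) (f₂ := fun k => (lam₂ k : ℂ)) ?_ (fun x => rfl) (fun x => rfl)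
    han₁ han₂ ?_ ?_ g f
  · intro ε hε
    obtain ⟨δ, hδ, h⟩ := hU ε hε
    refine ⟨δ, hδ, fun k hk g f => ?_⟩
    have := h k hk (toL2 (star g)) (toL2 f)
    rw [translation_toL2, translation_toL2, norm_toL2_star] at this
    exact this
  · rintro ⟨c, hc⟩
    exact hnc₁ ⟨lam₁ 0, fun k => Circle.ext ((hc k).trans (hc 0).symm)⟩
  · rintro ⟨l, hl⟩
    exact hnt ⟨l, fun k => Circle.ext (hl k)⟩

theorem exists_translation_bound_of_isUniform {T : TorusL2 p₁ →L[ℂ] TorusL2 p₂}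
    (hT : IsUniform (torusCoord p₁) (torusCoord p₂) T) :
    ∀ ε > 0, ∃ δ > 0, ∀ k : ℝ, |k| < δ → ∀ η ξ,
      ‖⟪translation p₂ k η, T (translation p₁ k ξ)⟫_ℂ - ⟪η, T ξ⟫_ℂ‖ ≤ ε * ‖η‖ * ‖ξ‖ := by
  intro ε hε
  obtain ⟨δ, hδ, h⟩ := Metric.continuous_iff.mp hT 0 ε hε
  refine ⟨δ, hδ, fun k hk η ξ => ?_⟩
  -- The sign is reversed because the translation of `η` passes to the other side of the inner
  -- product as its inverse.
  have h1 := h (-k) (by simpa [Real.dist_eq] using hk)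
  rw [dist_eq_norm] at h1
  have h0 : conjugate (torusCoord p₁) (torusCoord p₂) T 0 ξ = T ξ := by
    simp [conjugate, waveRep_torusCoord, translation_zero]
  have hk' : ⟪translation p₂ k η, T (translation p₁ k ξ)⟫_ℂ
      = ⟪η, conjugate (torusCoord p₁) (torusCoord p₂) T (-k) ξ⟫_ℂ := by
    simp only [conjugate, waveRep_torusCoord, ContinuousLinearMap.comp_apply,
      LinearIsometry.coe_toContinuousLinearMap, neg_neg]
    rw [← (translation p₂ (-k)).inner_map_map (translation p₂ k η), translation_translation,
      neg_add_cancel, translation_zero]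
  rw [hk', ← h0, ← inner_sub_right, ← _root_.sub_apply]
  calc _ ≤ ‖η‖ * _ := norm_inner_le_norm _ _
    _ ≤ ‖η‖ * (ε * ‖ξ‖) := by
      gcongr
      exact (ContinuousLinearMap.le_opNorm _ _).trans (by gcongr)
    _ = _ := by ring

theorem exists_translation_bound_of_hasFinitePropagation {T : TorusL2 p₁ →L[ℂ] TorusL2 p₂}
    (hT : HasFinitePropagation (torusCoord p₁) (torusCoord p₂) T) :
    ∀ ε > 0, ∃ δ > 0, ∀ k : ℝ, |k| < δ → ∀ η ξ,
      ‖⟪translation p₂ k η, T (translation p₁ k ξ)⟫_ℂ - ⟪η, T ξ⟫_ℂ‖ ≤ ε * ‖η‖ * ‖ξ‖ := by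
  intro ε hε
  obtain ⟨C, hC, h⟩ := exists_translation_bound hT (τ₁ := translation p₁) (τ₂ := translation p₂)
    translation_fourierBasis translation_fourierBasis
  -- The constant `C` may be zero, hence `C + 1`.
  refine ⟨ε / (C + 1), by positivity, fun k hk η ξ => (h k η ξ).trans ?_⟩
  have : C * |k| ≤ ε := by
    rw [lt_div_iff₀ (by positivity)] at hk
    nlinarith [abs_nonneg k]
  gcongr

end Intertwiner

/-! ### The equivalences -/

instance {p : ℝ} [Fact (0 < p)] : Nontrivial (TorusL2 p) :=
  ⟨fourierBasis (T := p) 0, 0, (fourierBasis (T := p)).orthonormal.ne_zero 0⟩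

theorem IsMinimalPeriod.eq_of_translate {f₁ f₂ : ℝ → Circle} {p₁ p₂ l : ℝ}
    (h₁ : IsMinimalPeriod f₁ p₁) (h₂ : IsMinimalPeriod f₂ p₂) (hl : ∀ k, f₂ k = f₁ (k - l)) :
    p₁ = p₂ := by
  refine le_antisymm (h₁.2 ⟨h₂.1.1, fun k => ?_⟩) (h₂.2 ⟨h₁.1.1, fun k => ?_⟩)
  · have := h₂.1.2 (k + l)
    rw [hl, hl] at this
    convert this using 2 <;> ring
  · rw [hl, hl, ← h₁.1.2 (k - l)]
    congr 1
    ring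

theorem translation_isIntertwiner {p : ℝ} [Fact (0 < p)] {lam₁ lam₂ : ℝ → Circle}
    (hc₁ : Continuous lam₁) (hc₂ : Continuous lam₂) (hp₁ : Function.Periodic lam₁ p)
    (hp₂ : Function.Periodic lam₂ p) {l : ℝ} (hl : ∀ k, lam₂ k = lam₁ (k - l)) :
    (modelWalk hc₁ hp₁).IsIntertwiner (modelWalk hc₂ hp₂)
      (translation p (-l)).toContinuousLinearMap := by
  refine fun ξ => translation_mulOp (fun x => ?_) ξ
  obtain ⟨s, rfl⟩ := QuotientAddGroup.mk_surjective x
  change lam₂ s = onTorus hc₁ hp₁ ((s : AddCircle p) + ((-l : ℝ) : AddCircle p))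
  rw [← AddCircle.coe_add, hl, sub_eq_add_neg]
  rfl

end QW

theorem mainTheorem7 (lam₁ lam₂ : ℝ → Circle)
    (han₁ : QW.IsAnalytic lam₁) (han₂ : QW.IsAnalytic lam₂)
    (hnc₁ : ¬ ∃ c, ∀ k, lam₁ k = c) (hnc₂ : ¬ ∃ c, ∀ k, lam₂ k = c)
    (p₁ p₂ : ℝ) [Fact (0 < p₁)] [Fact (0 < p₂)]
    (hp₁ : QW.IsMinimalPeriod lam₁ p₁) (hp₂ : QW.IsMinimalPeriod lam₂ p₂) :
    let W₁ : QW.QuantumWalk (QW.TorusL2 p₁) := QW.modelWalk han₁.continuous hp₁.periodic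
    let W₂ : QW.QuantumWalk (QW.TorusL2 p₂) := QW.modelWalk han₂.continuous hp₂.periodic
    List.TFAE [
      -- `lam₂` is a translate of `lam₁`
      ∃ l : ℝ, ∀ k : ℝ, lam₂ k = lam₁ (k - l),
      -- there is a unitary intertwiner with finite propagation
      ∃ V : QW.TorusL2 p₁ ≃ₗᵢ[ℂ] QW.TorusL2 p₂,
        W₁.IsIntertwiner W₂ (V.toContinuousLinearEquiv : QW.TorusL2 p₁ →L[ℂ] QW.TorusL2 p₂) ∧
        QW.HasFinitePropagation W₁.coord W₂.coord
          (V.toContinuousLinearEquiv : QW.TorusL2 p₁ →L[ℂ] QW.TorusL2 p₂),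
      -- the walks are similar
      W₁.Similar W₂,
      -- there is a non-zero uniform intertwiner
      ∃ T : QW.TorusL2 p₁ →L[ℂ] QW.TorusL2 p₂, T ≠ 0 ∧ W₁.IsIntertwiner W₂ T ∧
        QW.IsUniform W₁.coord W₂.coord T] := by
  intro W₁ W₂
  have hne : ∀ T : QW.TorusL2 p₁ ≃L[ℂ] QW.TorusL2 p₂,
      (T : QW.TorusL2 p₁ →L[ℂ] QW.TorusL2 p₂) ≠ 0 := by
    intro T h
    obtain ⟨ξ, hξ⟩ := exists_ne (0 : QW.TorusL2 p₁)
    exact hξ (T.injective ((congrArg (fun S : QW.TorusL2 p₁ →L[ℂ] QW.TorusL2 p₂ => S ξ) h).trans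
      (map_zero T).symm))
  tfae_have 1 → 2 := by
    rintro ⟨l, hl⟩
    -- Minimality of the periods enters only in the implications from 1: the two Hilbert spaces
    -- become the same, so that translation maps one to the other.
    obtain rfl := hp₁.eq_of_translate hp₂ hl
    exact ⟨QW.translationEquiv p₁ (-l),
      QW.translation_isIntertwiner han₁.continuous han₂.continuous hp₁.periodic hp₂.periodic hl,
      QW.hasFinitePropagation_translation (-l)⟩
  tfae_have 1 → 3 := by
    rintro ⟨l, hl⟩
    obtain rfl := hp₁.eq_of_translate hp₂ hl
    exact ⟨(QW.translationEquiv p₁ (-l)).toContinuousLinearEquiv,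
      QW.translation_isIntertwiner han₁.continuous han₂.continuous hp₁.periodic hp₂.periodic hl,
      QW.isSmooth_translation (-l)⟩
  tfae_have 3 → 4 := by
    rintro ⟨T, hT, hs⟩
    exact ⟨T, hne T, hT, hs.continuous⟩
  tfae_have 2 → 1 := by
    rintro ⟨V, hV, hf⟩
    exact QW.exists_translate han₁ han₂ hnc₁ hp₁.periodic hp₂.periodic (hne _) hV
      (QW.exists_translation_bound_of_hasFinitePropagation hf)
  tfae_have 4 → 1 := by
    rintro ⟨T, hT0, hT, hu⟩
    exact QW.exists_translate han₁ han₂ hnc₁ hp₁.periodic hp₂.periodic hT0 hT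
      (QW.exists_translation_bound_of_isUniform hu)
  tfae_finish
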